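/- **Setting.** Norms are Euclidean/spectral. Consider $\min f(x)$ s.t. $c(x)=0$ with $f:\mathbb R^n\to\mathbb R$, $c:\mathbb R^n\to\mathbb R^m$, $J(x)=\nabla c(x)^T$, and let $\mathcal X\subseteq\mathbb R^n$ be open and convex. On $\mathcal X$: $f,c$ are $C^1$, $\nabla f$ is $L$-Lipschitz ($L>0$), $J$ is $\Gamma$-Lipschitz ($\Gamma\ge0$; $\Gamma>0$ for Option I), $f_{\inf}\le f\le f_{\sup}$, $\|\nabla f\|\le\kappa_g$, $\|c\|\le\kappa_c$, $\|J\|\le\kappa_J$ ($\kappa_g,\kappa_c,\kappa_J>0$), and the noisy evaluations satisfy $|\bar f-f|\le\epsilon_f$, $\|\bar g-\nabla f\|\le\epsilon_g$, $\|\bar c-c\|\le\epsilon_c$, $\|\bar J-J\|\le\epsilon_J$, with all $\epsilon$'s $\ge 0$. Let $\epsilon_o\in[0,\epsilon_c]$. A subscript $k$ means evaluation at $x_k$. Put $\Delta\bar l(x,\tau,d)=-\tau\bar g(x)^Td+\|\bar c(x)\|-\|\bar c(x)+\bar J(x)d\|$. **Parameters.** $\sigma_{Jc},\kappa_H,\zeta,\kappa_{\rho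 r},\lambda_{uv},\lambda_v,\theta,\sigma_\chi,\bar\tau_{-1},\bar\chi_{-1},\bar\zeta_{-1},\bar\xi_{-1}>0$; $\bar\gamma_c,\beta,\alpha_u^L\in(0,1]$; $\lambda_{\rho r},\sigma_u,\sigma_c,\sigma_\tau,\eta,\sigma_\zeta,\sigma_\xi,\nu\in(0,1)$; $\sigma_r\in(\sigma_c,1)$; $\lambda_u\in(0,\zeta)$. **Algorithm.** Given $x_0$, for $k=0,1,2,\dots$, with $M_k=\max\{\bar u_k^TH_k\bar u_k,\lambda_u\|\bar u_k\|^2\}$, $\bar\rho_k=H_k\bar u_k+\bar J_k^T\bar y_k+\bar g_k+H_k\bar v_k$, $\bar r_k=\bar J_k\bar u_k$, $\bar d_k=\bar v_k+\bar u_k$, $N_k=\|\bar c_k\|-\|\bar c_k+\bar J_k\bar v_k\|$, $F_k=\|\bar c_k\|-\|\bar c_k+\bar J_k\bar v_k+\bar r_k\|$, and always requiring $$\max\{\|\bar\rho_k\|,\|\bar r_k\|\}\le\lambda_{\rho r}\min\{\max\{\|\bar u_k\|,\|\bar J_k^T\bar c_k\|\},\kappa_{\rho r}\}:$$ * If $\|\bar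 c_k\|\le\epsilon_o$: $\bar v_k=0$, $\bar\tau_k=\bar\tau_{k-1}$, and $(\bar u_k,\bar y_k)$ satisfies $\bar u_k^TH_k\bar u_k\ge\lambda_u\|\bar u_k\|^2-\epsilon_o$, $\bar g_k^T\bar u_k+\frac12\bar u_k^TH_k\bar u_k\le\epsilon_o$, $\Delta\bar l(x_k,\bar\tau_{k-1},\bar u_k)\ge\bar\tau_{k-1}\sigma_uM_k-\epsilon_o$. Terminate if $\Delta\bar l(x_k,\bar\tau_k,\bar d_k)\le\epsilon_o$. * If $\|\bar c_k\|>\epsilon_o$: terminate if $\bar J_k^T\bar c_k=0$. Otherwise $\bar v_k\in\mathrm{Range}(\bar J_k^T)$, $\|\bar v_k\|\le\sigma_{Jc}\|\bar J_k^T\bar c_k\|$ and $N_k\ge\bar\gamma_c(\|\bar c_k\|-\|\bar c_k-\bar\alpha_k^c\bar J_k\bar J_k^T\bar c_k\|)$ with $\bar\alpha_k^c=\min\{\sigma_{Jc},\|\bar J_k^T\bar c_k\|^2/\|\bar J_k\bar J_k^T\bar c_k\|^2\}$; and $(\bar u_k,\bar y_k)$ satisfies: either $\|\bar u_k\|\le\lambda_{uv}\|\bar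 v_k\|$, or both $\bar u_k^TH_k\bar u_k\ge\lambda_u\|\bar u_k\|^2$ and $(\bar g_k+H_k\bar v_k)^T\bar u_k+\max\{\frac12,1-\|\bar J_k^T\bar c_k\|\}\bar u_k^TH_k\bar u_k\le\lambda_v\|\bar v_k\|$; together with (a) $\Delta\bar l(x_k,\bar\tau_{k-1},\bar d_k)\ge\bar\tau_{k-1}\sigma_uM_k+\sigma_cN_k$ or (b) $F_k\ge\sigma_rN_k>0$. If (a) holds, $\bar\tau_k=\bar\tau_{k-1}$. If not, let $\bar\tau_k^{\rm trial}=\infty$ if $\bar g_k^T\bar d_k+M_k\le0$ and $\bar\tau_k^{\rm trial}=(1-\sigma_c/\sigma_r)F_k/(\bar g_k^T\bar d_k+M_k)$ otherwise, and set $\bar\tau_k=\bar\tau_{k-1}$ if $\bar\tau_{k-1}\le(1-\sigma_\tau)\bar\tau_k^{\rm trial}$, $\bar\tau_k=(1-\sigma_\tau)\bar\tau_k^{\rm trial}$ otherwise. * *Option I.* $(\bar\chi_k,\bar\zeta_k)=((1+\sigma_\chi)\bar\chi_{k-1},(1-\sigma_\zeta)\bar\zeta_{k-1})$ if $\|\bar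 u_k\|^2\ge\bar\chi_{k-1}\|\bar v_k\|^2$ and $\frac12\bar d_k^TH_k\bar d_k<\frac14\bar\zeta_{k-1}\|\bar u_k\|^2$; otherwise these values are unchanged. With $\delta_k=\Delta\bar l(x_k,\bar\tau_k,\bar d_k)$, let $t_k=\bar\tau_k$ if $\|\bar u_k\|^2\ge\bar\chi_k\|\bar v_k\|^2$ and $t_k=1$ otherwise; $\bar\xi_k^{\rm trial}=\delta_k/(t_k\|\bar d_k\|^2)$; $\bar\xi_k=\bar\xi_{k-1}$ if $\bar\xi_{k-1}\le\bar\xi_k^{\rm trial}$, else $\bar\xi_k=\min\{(1-\sigma_\xi)\bar\xi_{k-1},\bar\xi_k^{\rm trial}\}$. Then $\bar\alpha_k$ is the projection of $\min\{2(1-\eta)\beta\delta_k/((\bar\tau_kL+\Gamma)\|\bar d_k\|^2),1\}$ onto $[\bar\alpha_k^{\min},\bar\alpha_k^{\min}+\theta\beta]$, $\bar\alpha_k^{\min}=2(1-\eta)\beta\bar\xi_kt_k/(\bar\tau_kL+\Gamma)$. * *Option II.* $\bar\alpha_k=\alpha_u^L\nu^j$ with the smallest $j\ge0$ such that, for $\alpha=\alpha_u^L\nu^j$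 and $\bar\phi(x,\tau)=\tau\bar f(x)+\|\bar c(x)\|$, $\bar\phi(x_k+\alpha\bar d_k,\bar\tau_k)\le\bar\phi(x_k,\bar\tau_k)-\eta\alpha\Delta\bar l(x_k,\bar\tau_k,\bar d_k)+\epsilon_{A_k}$, where $\epsilon_{A_k}=2\bar\tau_k\epsilon_f+4\epsilon_c+\bar\tau_k\alpha_u^L\epsilon_g\|\bar d_k\|+\alpha_u^L\epsilon_J\|\bar d_k\|$. * $x_{k+1}=x_k+\bar\alpha_k\bar d_k$. **Assumptions on the run.** All $x_k$ and $x_k+\bar d_k$ lie in $\mathcal X$. $\|H_k\|\le\kappa_H$ and $w^TH_kw\ge\zeta\|w\|^2$ for $w\in\mathrm{Null}(J_k)\cup\mathrm{Null}(\bar J_k)$. For each $k$, $(\bar u_k,\bar y_k)$ is a member of a sequence $(\bar u_{k,t},\bar y_{k,t})_{t\in\mathbb N}$ whose residuals $H_k\bar u_{k,t}+\bar J_k^T\bar y_{k,t}+\bar g_k+H_k\bar v_k$ and $\bar J_k\bar u_{k,t}$ tend to $0$ and for which $\bar u_{k,t}\to\bar u_k^*$ as $t\to\infty$, where $H_k\bar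 u_k^*+\bar J_k^T\bar y_k^*=-(\bar g_k+H_k\bar v_k)$, $\bar J_k\bar u_k^*=0$ for some $\bar y_k^*$. For each $k$, $\bar J_k^T\bar c_k\ne0$ or $\bar g_k\notin\mathrm{Range}(\bar J_k^T)$. The algorithm never terminates. **Theorem.** Fix $n$, $m$, the parameters and the option $i\in\{A,L\}$ ($A$: Option I, $L$: Option II), and consider runs as above with $\bar\tau_k\to0$. For $\gamma>0$ let $\mathcal X_\gamma=\{x:\|\bar J(x)^T\bar c(x)\|\ge\gamma,\ \|\bar c(x)\|>\epsilon_o\}$. 1. There are $\sigma_v,\kappa_{\bar d}>0$ and, for every $\gamma>0$, a number $\alpha_{l0}^i(\gamma)>0$, depending only on $n$, $m$, $i$, the parameters and the noise levels, such that for every such run: $\|\bar c_k\|N_k\ge\sigma_v\|\bar J_k^T\bar c_k\|^2$ whenever $\|\bar c_k\|>\epsilon_o$; $\|\bar d_k\|\le\kappa_{\bar d}$ for all $k$; and $\bar\alpha_k\ge\alpha_{l0}^i(\gamma)$ whenever $x_k\in\mathcal X_\gamma$. 2. Let $\alpha_u^A=\big(2(1-\eta)\bar\xi_{-1}\max\{\bar\tau_{-1},1\}/\Gamma+\theta\big)\beta$,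 $\mathcal E_c^A=2\epsilon_c+\alpha_u^A\kappa_{\bar d}\epsilon_J$, $\mathcal E_c^L=6\epsilon_c+\alpha_u^L\kappa_{\bar d}\epsilon_J$. For every such run, all positive constants $\sigma_v$, $\kappa_{\bar d}$, $\gamma$, $\alpha_{l0}^i$ having the properties in 1 for that run, and every $\sigma_\gamma\in(0,1)$, $$\liminf_{k\to\infty}\|J_k^Tc_k\|\le B:=\max\left\{\epsilon_c(\epsilon_J+\kappa_J)+\kappa_c\epsilon_J+\sqrt{\frac{(1+\sigma_\gamma)(\kappa_c+\epsilon_c)\mathcal E_c^i}{\eta\,\alpha_{l0}^i\,\sigma_c\,\sigma_v}},\ 2\kappa_J\epsilon_c\right\}.$$ If in addition the $m$ singular values of every $J_k$ are bounded below by $\kappa_\sigma>0$, then $\liminf_{k\to\infty}\|c_k\|\le\kappa_\sigma^{-1}B$. 3. There is a constant $C\ge0$ independent of the noise levels and of the run such that, whenever $\epsilon_c,\epsilon_J\le1$, $\liminf_k\|J_k^Tc_k\|\le C(\epsilon_c+\epsilon_J)^{1/2}$, and, under the additional condition on the singular values, $\liminf_k\|c_k\|\le\kappa_\sigma^{-1}C(\epsilon_c+\epsilon_J)^{1/2}$.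 -/

import Mathlib

open Filter Topology
open scoped InnerProductSpace

namespace NoisySQP

noncomputable section

/-- `ℝⁿ` with the Euclidean norm. -/
abbrev Vec (n : ℕ) : Type := EuclideanSpace ℝ (Fin n)

/-- An `m × n` real matrix seen as a linear map `ℝⁿ → ℝᵐ`; its norm is the spectral norm. -/
abbrev Mat (m n : ℕ) : Type := Vec n →L[ℝ] Vec m

/-- The transpose of a real matrix. -/
abbrev tr {m n : ℕ} (A : Mat m n) : Mat n m := ContinuousLinearMap.adjoint A

/-- The two step size schemes: Option I (adaptive) and Option II (line search). -/
inductive StepOption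
  | adaptive
  | lineSearch

/-- Constants of the problem and user-chosen parameters of the algorithm. -/
structure Params where
  /-- Lipschitz constant `L` of `∇f` -/
  L : ℝ
  /-- Lipschitz constant `Γ` of the Jacobian of `c` -/
  Gam : ℝ
  /-- lower and upper bound of `f` -/
  fInf : ℝ
  fSup : ℝ
  /-- bounds `κ_g, κ_c, κ_J` of `∇f`, `c` and the Jacobian of `c` -/
  kapG : ℝ
  kapC : ℝ
  kapJ : ℝ
  /-- bound `κ_H` of the matrices `H_k`, and their curvature constant `ζ` on the null spaces -/
  kapH : ℝ
  zeta : ℝ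
  /-- trust region and Cauchy decrease parameters `σ_{Jc}`, `γ_c` of the normal subproblem -/
  sigJc : ℝ
  gamC : ℝ
  /-- parameters `λ_{ρr}, κ_{ρr}, λ_u, λ_{uv}, λ_v, σ_u, σ_c, σ_r, σ_τ` of the termination tests
  and of the merit parameter update -/
  lamRr : ℝ
  kapRr : ℝ
  lamU : ℝ
  lamUV : ℝ
  lamV : ℝ
  sigU : ℝ
  sigC : ℝ
  sigR : ℝ
  sigTau : ℝ
  /-- initial merit parameter `τ_{-1}` -/
  tauInit : ℝ
  /-- sufficient decrease parameter `η` -/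
  eta : ℝ
  /-- Option I: `β, θ, σ_χ, σ_ζ, σ_ξ` and the initial values `χ_{-1}, ζ_{-1}, ξ_{-1}` -/
  beta : ℝ
  theta : ℝ
  sigChi : ℝ
  sigZeta : ℝ
  sigXi : ℝ
  chiInit : ℝ
  zetaInit : ℝ
  xiInit : ℝ
  /-- Option II: initial step size `α_u^L` and backtracking factor `ν` -/
  alphaL : ℝ
  nu : ℝ

/-- The admissible ranges of the constants. Option I uses `Γ` as a positive input; otherwise only
`Γ ≥ 0` is needed. (No smallness condition linking `β` to the other parameters is imposed.) -/
structure Params.Admissible (P : Params) (opt : StepOption) : Prop where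
  L_pos : 0 < P.L
  Gam_nonneg : 0 ≤ P.Gam
  Gam_pos : opt = StepOption.adaptive → 0 < P.Gam
  kapG_pos : 0 < P.kapG
  kapC_pos : 0 < P.kapC
  kapJ_pos : 0 < P.kapJ
  kapH_pos : 0 < P.kapH
  zeta_pos : 0 < P.zeta
  sigJc_pos : 0 < P.sigJc
  gamC_mem : P.gamC ∈ Set.Ioc (0 : ℝ) 1
  lamRr_mem : P.lamRr ∈ Set.Ioo (0 : ℝ) 1
  kapRr_pos : 0 < P.kapRr
  lamU_mem : P.lamU ∈ Set.Ioo 0 P.zeta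
  lamUV_pos : 0 < P.lamUV
  lamV_pos : 0 < P.lamV
  sigU_mem : P.sigU ∈ Set.Ioo (0 : ℝ) 1
  sigC_mem : P.sigC ∈ Set.Ioo (0 : ℝ) 1
  sigR_mem : P.sigR ∈ Set.Ioo P.sigC 1
  sigTau_mem : P.sigTau ∈ Set.Ioo (0 : ℝ) 1
  tauInit_pos : 0 < P.tauInit
  eta_mem : P.eta ∈ Set.Ioo (0 : ℝ) 1
  beta_mem : P.beta ∈ Set.Ioc (0 : ℝ) 1
  theta_pos : 0 < P.theta
  sigChi_pos : 0 < P.sigChi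
  sigZeta_mem : P.sigZeta ∈ Set.Ioo (0 : ℝ) 1
  sigXi_mem : P.sigXi ∈ Set.Ioo (0 : ℝ) 1
  chiInit_pos : 0 < P.chiInit
  zetaInit_pos : 0 < P.zetaInit
  xiInit_pos : 0 < P.xiInit
  alphaL_mem : P.alphaL ∈ Set.Ioc (0 : ℝ) 1
  nu_mem : P.nu ∈ Set.Ioo (0 : ℝ) 1

/-- Noise levels `ε_f, ε_g, ε_c, ε_J` and the optimistic feasibility parameter `ε_o`. -/
structure Noise where
  epsF : ℝ
  epsG : ℝ
  epsC : ℝ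
  epsJ : ℝ
  epsO : ℝ

structure Noise.Admissible (N : Noise) : Prop where
  epsF_nonneg : 0 ≤ N.epsF
  epsG_nonneg : 0 ≤ N.epsG
  epsC_nonneg : 0 ≤ N.epsC
  epsJ_nonneg : 0 ≤ N.epsJ
  epsO_mem : N.epsO ∈ Set.Icc 0 N.epsC

/-- The problem `min f(x) s.t. c(x) = 0`, the set `𝒳`, and the noisy evaluations. -/
structure Problem (n m : ℕ) where
  f : Vec n → ℝ
  c : Vec n → Vec m
  dom : Set (Vec n)
  fBar : Vec n → ℝ
  gBar : Vec n → Vec n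
  cBar : Vec n → Vec m
  jBar : Vec n → Mat m n

namespace Problem

variable {n m : ℕ} (Q : Problem n m)

/-- The true Jacobian `J(x) = ∇c(x)ᵀ`. -/
def jac (x : Vec n) : Mat m n := fderiv ℝ Q.c x

/-- `J(x)ᵀ c(x)`, whose norm is the infeasible stationarity error. -/
def jtc (x : Vec n) : Vec n := tr (Q.jac x) (Q.c x)

/-- The noisy counterpart of `J(x)ᵀ c(x)`. -/
def jtcBar (x : Vec n) : Vec n := tr (Q.jBar x) (Q.cBar x)

/-- Smoothness and boundedness of `f` and `c` over the open convex set `𝒳`. -/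
structure Smooth (P : Params) : Prop where
  dom_open : IsOpen Q.dom
  dom_convex : Convex ℝ Q.dom
  f_contDiff : ContDiffOn ℝ 1 Q.f Q.dom
  c_contDiff : ContDiffOn ℝ 1 Q.c Q.dom
  grad_lipschitz : ∀ x ∈ Q.dom, ∀ y ∈ Q.dom,
    ‖gradient Q.f x - gradient Q.f y‖ ≤ P.L * ‖x - y‖
  jac_lipschitz : ∀ x ∈ Q.dom, ∀ y ∈ Q.dom, ‖Q.jac x - Q.jac y‖ ≤ P.Gam * ‖x - y‖
  f_bound : ∀ x ∈ Q.dom, P.fInf ≤ Q.f x ∧ Q.f x ≤ P.fSup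
  grad_bound : ∀ x ∈ Q.dom, ‖gradient Q.f x‖ ≤ P.kapG
  c_bound : ∀ x ∈ Q.dom, ‖Q.c x‖ ≤ P.kapC
  jac_bound : ∀ x ∈ Q.dom, ‖Q.jac x‖ ≤ P.kapJ

/-- The noise in all evaluations is bounded over `𝒳`. -/
structure BoundedNoise (N : Noise) : Prop where
  f_err : ∀ x ∈ Q.dom, |Q.fBar x - Q.f x| ≤ N.epsF
  g_err : ∀ x ∈ Q.dom, ‖Q.gBar x - gradient Q.f x‖ ≤ N.epsG
  c_err : ∀ x ∈ Q.dom, ‖Q.cBar x - Q.c x‖ ≤ N.epsC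
  j_err : ∀ x ∈ Q.dom, ‖Q.jBar x - Q.jac x‖ ≤ N.epsJ

/-- The noisy merit function `τ f̄(x) + ‖c̄(x)‖`. -/
def meritBar (x : Vec n) (τ : ℝ) : ℝ := τ * Q.fBar x + ‖Q.cBar x‖

/-- The reduction `Δl̄(x, τ, d)` of the model of the merit function. -/
def modelRed (x : Vec n) (τ : ℝ) (d : Vec n) : ℝ :=
  -τ * ⟪Q.gBar x, d⟫_ℝ + ‖Q.cBar x‖ - ‖Q.cBar x + Q.jBar x d‖

/-- The set `𝒳_γ`. -/
def levelSet (N : Noise) (γ : ℝ) : Set (Vec n) :=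
  {x | γ ≤ ‖Q.jtcBar x‖ ∧ N.epsO < ‖Q.cBar x‖}

end Problem

/-- The sequences produced by an infinite run of the algorithm. The merit parameters are shifted by
one: `tau k` is `τ̄_{k-1}`, so that `tau 0` is the initial value and `tau (k + 1)` is `τ̄_k`. -/
structure Run (n m : ℕ) where
  x : ℕ → Vec n
  H : ℕ → Mat n n
  v : ℕ → Vec n
  u : ℕ → Vec n
  y : ℕ → Vec m
  d : ℕ → Vec n
  tau : ℕ → ℝ
  alpha : ℕ → ℝ

namespace Run

variable {n m : ℕ} (R : Run n m) (P : Params) (N : Noise) (Q : Problem n m)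

/-- First residual block, `H_k u + J̄_kᵀ y + ḡ_k + H_k v̄_k`. -/
def dualRes (k : ℕ) (u : Vec n) (y : Vec m) : Vec n :=
  R.H k u + tr (Q.jBar (R.x k)) y + (Q.gBar (R.x k) + R.H k (R.v k))

/-- The dual residual `ρ̄_k`. -/
def rho (k : ℕ) : Vec n := R.dualRes Q k (R.u k) (R.y k)

/-- The primal residual `r̄_k = J̄_k ū_k`. -/
def r (k : ℕ) : Vec m := Q.jBar (R.x k) (R.u k)

/-- `ū_kᵀ H_k ū_k`. -/
def curv (k : ℕ) : ℝ := ⟪R.u k, R.H k (R.u k)⟫_ℝ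

/-- `max {ū_kᵀ H_k ū_k, λ_u ‖ū_k‖²}`. -/
def maxCurv (k : ℕ) : ℝ := max (R.curv k) (P.lamU * ‖R.u k‖ ^ 2)

/-- `‖c̄_k‖ - ‖c̄_k + J̄_k v̄_k‖`. -/
def normalRed (k : ℕ) : ℝ :=
  ‖Q.cBar (R.x k)‖ - ‖Q.cBar (R.x k) + Q.jBar (R.x k) (R.v k)‖

/-- `‖c̄_k‖ - ‖c̄_k + J̄_k v̄_k + r̄_k‖`. -/
def fullRed (k : ℕ) : ℝ :=
  ‖Q.cBar (R.x k)‖ - ‖Q.cBar (R.x k) + Q.jBar (R.x k) (R.v k) + R.r Q k‖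

/-- `Δl̄(x_k, τ̄_k, d̄_k)`. -/
def modelRedAt (k : ℕ) : ℝ := Q.modelRed (R.x k) (R.tau (k + 1)) (R.d k)

/-- The Cauchy step length along `-J̄_kᵀ c̄_k`. -/
def cauchyLen (k : ℕ) : ℝ :=
  min P.sigJc (‖Q.jtcBar (R.x k)‖ ^ 2 / ‖Q.jBar (R.x k) (Q.jtcBar (R.x k))‖ ^ 2)

/-- `v̄_k` is feasible for the trust region subproblem
`min ½‖c̄_k + J̄_k v‖²` over `v ∈ Range(J̄_kᵀ)`, `‖v‖ ≤ σ_{Jc}‖J̄_kᵀ c̄_k‖`,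
and satisfies the Cauchy-like decrease condition. -/
structure NormalStep (k : ℕ) : Prop where
  mem_range : R.v k ∈ Set.range (tr (Q.jBar (R.x k)))
  trust_region : ‖R.v k‖ ≤ P.sigJc * ‖Q.jtcBar (R.x k)‖
  cauchy_decrease : P.gamC * (‖Q.cBar (R.x k)‖ -
      ‖Q.cBar (R.x k) + R.cauchyLen P Q k • Q.jBar (R.x k) (-Q.jtcBar (R.x k))‖)
    ≤ R.normalRed Q k

/-- The residual condition common to both termination tests. -/
def ResidualTest (k : ℕ) : Prop :=
  max ‖R.rho Q k‖ ‖R.r Q k‖ ≤ P.lamRr * min (max ‖R.u k‖ ‖Q.jtcBar (R.x k)‖) P.kapRr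

/-- Termination Test 1. -/
structure Test1 (k : ℕ) : Prop where
  residual : R.ResidualTest P Q k
  curvature : P.lamU * ‖R.u k‖ ^ 2 - N.epsO ≤ R.curv k
  descent : ⟪Q.gBar (R.x k), R.u k⟫_ℝ + 1 / 2 * R.curv k ≤ N.epsO
  model : R.tau k * P.sigU * R.maxCurv P k - N.epsO ≤ Q.modelRed (R.x k) (R.tau k) (R.u k)

/-- Termination Test 2, model reduction condition with the old merit parameter. -/
def ModelTest (k : ℕ) : Prop :=
  R.tau k * P.sigU * R.maxCurv P k + P.sigC * R.normalRed Q k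
    ≤ Q.modelRed (R.x k) (R.tau k) (R.d k)

/-- Termination Test 2, condition on the reduction of the linearized constraint violation. -/
def FeasTest (k : ℕ) : Prop :=
  P.sigR * R.normalRed Q k ≤ R.fullRed Q k ∧ 0 < P.sigR * R.normalRed Q k

/-- Termination Test 2. -/
structure Test2 (k : ℕ) : Prop where
  residual : R.ResidualTest P Q k
  tangential : ‖R.u k‖ ≤ P.lamUV * ‖R.v k‖ ∨
    (P.lamU * ‖R.u k‖ ^ 2 ≤ R.curv k ∧
      ⟪Q.gBar (R.x k) + R.H k (R.v k), R.u k⟫_ℝ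
          + max (1 / 2) (1 - ‖Q.jtcBar (R.x k)‖) * R.curv k
        ≤ P.lamV * ‖R.v k‖)
  reduction : R.ModelTest P Q k ∨ R.FeasTest P Q k

/-- Denominator `ḡ_kᵀ d̄_k + max {ū_kᵀ H_k ū_k, λ_u ‖ū_k‖²}` of the trial merit parameter. -/
def trialDen (k : ℕ) : ℝ := ⟪Q.gBar (R.x k), R.d k⟫_ℝ + R.maxCurv P k

/-- The trial merit parameter when it is finite; it is `∞` if `trialDen ≤ 0`. -/
def tauTrial (k : ℕ) : ℝ := (1 - P.sigC / P.sigR) * R.fullRed Q k / R.trialDen P Q k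

/-- The updated merit parameter when the model reduction condition fails. The first branch is
`τ̄_k^trial = ∞`. -/
def tauUpdated (k : ℕ) : ℝ :=
  if R.trialDen P Q k ≤ 0 then R.tau k
  else if R.tau k ≤ (1 - P.sigTau) * R.tauTrial P Q k then R.tau k
  else (1 - P.sigTau) * R.tauTrial P Q k

/-- Auxiliary sequences of Option I, shifted by one: `chi k` is `χ̄_{k-1}`, etc. -/
structure Aux where
  chi : ℕ → ℝ
  zeta : ℕ → ℝ
  xi : ℕ → ℝ

/-- The condition that triggers an update of `(χ̄, ζ̄)`. -/
def DominateCond (S : Aux) (k : ℕ) : Prop :=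
  S.chi k * ‖R.v k‖ ^ 2 ≤ ‖R.u k‖ ^ 2 ∧
    1 / 2 * ⟪R.v k + R.u k, R.H k (R.v k + R.u k)⟫_ℝ < 1 / 4 * S.zeta k * ‖R.u k‖ ^ 2

def xiTrial (S : Aux) (k : ℕ) : ℝ :=
  if S.chi (k + 1) * ‖R.v k‖ ^ 2 ≤ ‖R.u k‖ ^ 2 then
    R.modelRedAt Q k / (R.tau (k + 1) * ‖R.d k‖ ^ 2)
  else R.modelRedAt Q k / ‖R.d k‖ ^ 2

def alphaSuff (k : ℕ) : ℝ :=
  min (2 * (1 - P.eta) * P.beta * R.modelRedAt Q k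
    / ((R.tau (k + 1) * P.L + P.Gam) * ‖R.d k‖ ^ 2)) 1

def alphaMin (S : Aux) (k : ℕ) : ℝ :=
  if S.chi (k + 1) * ‖R.v k‖ ^ 2 ≤ ‖R.u k‖ ^ 2 then
    2 * (1 - P.eta) * P.beta * S.xi (k + 1) * R.tau (k + 1) / (R.tau (k + 1) * P.L + P.Gam)
  else 2 * (1 - P.eta) * P.beta * S.xi (k + 1) / (R.tau (k + 1) * P.L + P.Gam)

def alphaMax (S : Aux) (k : ℕ) : ℝ := R.alphaMin P S k + P.theta * P.beta

/-- Option I: the step size is the projection of `alphaSuff` onto `[alphaMin, alphaMax]`. -/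
structure AdaptiveSteps (S : Aux) : Prop where
  chi_init : S.chi 0 = P.chiInit
  zeta_init : S.zeta 0 = P.zetaInit
  xi_init : S.xi 0 = P.xiInit
  update : ∀ k, R.DominateCond S k →
    S.chi (k + 1) = (1 + P.sigChi) * S.chi k ∧ S.zeta (k + 1) = (1 - P.sigZeta) * S.zeta k
  keep : ∀ k, ¬ R.DominateCond S k → S.chi (k + 1) = S.chi k ∧ S.zeta (k + 1) = S.zeta k
  xi_update : ∀ k, S.xi (k + 1) =
    if S.xi k ≤ R.xiTrial Q S k then S.xi k
    else min ((1 - P.sigXi) * S.xi k) (R.xiTrial Q S k)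
  step : ∀ k, R.alpha k = max (R.alphaMin P S k) (min (R.alphaMax P S k) (R.alphaSuff P Q k))

/-- The line search relaxation parameter `ε_{A_k}`. -/
def relaxation (k : ℕ) : ℝ :=
  2 * R.tau (k + 1) * N.epsF + 4 * N.epsC + R.tau (k + 1) * P.alphaL * N.epsG * ‖R.d k‖
    + P.alphaL * N.epsJ * ‖R.d k‖

/-- The relaxed Armijo condition at iteration `k` for the step size `a`. -/
def Armijo (k : ℕ) (a : ℝ) : Prop :=
  Q.meritBar (R.x k + a • R.d k) (R.tau (k + 1))
    ≤ Q.meritBar (R.x k) (R.tau (k + 1)) - P.eta * a * R.modelRedAt Q k + R.relaxation P N k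

/-- Option II: backtracking from `α_u^L` by the factor `ν` until the Armijo condition holds. -/
def LineSearchSteps : Prop :=
  ∀ k, ∃ j : ℕ, R.alpha k = P.alphaL * P.nu ^ j ∧ R.Armijo P N Q k (P.alphaL * P.nu ^ j) ∧
    ∀ i < j, ¬ R.Armijo P N Q k (P.alphaL * P.nu ^ i)

/-- The step sizes are chosen by the given option. -/
def StepSizes : StepOption → Prop
  | StepOption.adaptive => ∃ S : Aux, R.AdaptiveSteps P Q S
  | StepOption.lineSearch => R.LineSearchSteps P N Q

/-- The sequences are generated by the algorithm with the given step size option. -/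
structure Generated (opt : StepOption) : Prop where
  tau_init : R.tau 0 = P.tauInit
  /-- an (optimistically) feasible iterate -/
  feasible : ∀ k, ‖Q.cBar (R.x k)‖ ≤ N.epsO →
    R.v k = 0 ∧ R.tau (k + 1) = R.tau k ∧ R.Test1 P N Q k
  /-- an infeasible iterate -/
  infeasible : ∀ k, N.epsO < ‖Q.cBar (R.x k)‖ →
    R.NormalStep P Q k ∧ R.Test2 P Q k ∧
      (R.ModelTest P Q k → R.tau (k + 1) = R.tau k) ∧
      (¬ R.ModelTest P Q k → R.tau (k + 1) = R.tauUpdated P Q k)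
  direction : ∀ k, R.d k = R.v k + R.u k
  stepSize : R.StepSizes P N Q opt
  next : ∀ k, R.x (k + 1) = R.x k + R.alpha k • R.d k

/-- The algorithm never terminates, on either of its two termination criteria. -/
structure NoTermination : Prop where
  not_stationary : ∀ k, ‖Q.cBar (R.x k)‖ ≤ N.epsO → N.epsO < R.modelRedAt Q k
  not_infeasible_stationary : ∀ k, N.epsO < ‖Q.cBar (R.x k)‖ → Q.jtcBar (R.x k) ≠ 0

/-- The matrices `H_k` are bounded, and uniformly positive definite on the null spaces of the true
and of the noisy Jacobian. -/
structure HessianBounds : Prop where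
  bound : ∀ k, ‖R.H k‖ ≤ P.kapH
  pos : ∀ k, ∀ w : Vec n, (Q.jac (R.x k) w = 0 ∨ Q.jBar (R.x k) w = 0) →
    P.zeta * ‖w‖ ^ 2 ≤ ⟪w, R.H k w⟫_ℝ

/-- At iteration `k` the iterative linear solver produces inexact solutions `(ū_{k,t}, ȳ_{k,t})`,
`t ∈ ℕ`, such that `ū_{k,t}` tends to the exact tangential solution and the residuals tend to zero;
the pair used by the algorithm is one of them. -/
def InexactSolver : Prop :=
  ∀ k, ∃ (uSol : Vec n) (ySol : Vec m) (us : ℕ → Vec n) (ys : ℕ → Vec m),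
    R.dualRes Q k uSol ySol = 0 ∧ Q.jBar (R.x k) uSol = 0 ∧
    Tendsto us atTop (𝓝 uSol) ∧
    Tendsto (fun t => R.dualRes Q k (us t) (ys t)) atTop (𝓝 0) ∧
    Tendsto (fun t => Q.jBar (R.x k) (us t)) atTop (𝓝 0) ∧
    ∃ t, R.u k = us t ∧ R.y k = ys t

/-- For every `k`, `J̄_kᵀ c̄_k ≠ 0` or `ḡ_k ∉ Range(J̄_kᵀ)`. -/
def Nondegenerate : Prop :=
  ∀ k, Q.jtcBar (R.x k) ≠ 0 ∨ Q.gBar (R.x k) ∉ Set.range (tr (Q.jBar (R.x k)))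

/-- All standing assumptions on the problem, the noise, and a nonterminating run. -/
structure Standing (opt : StepOption) : Prop where
  smooth : Q.Smooth P
  noise : Q.BoundedNoise N
  iterates_mem : ∀ k, R.x k ∈ Q.dom
  trial_mem : ∀ k, R.x k + R.d k ∈ Q.dom
  generated : R.Generated P N Q opt
  hessian : R.HessianBounds P Q
  solver : R.InexactSolver Q
  nondegenerate : R.Nondegenerate Q
  noTermination : R.NoTermination N Q

/-- `σ_v` is a constant of sufficient linearized decrease for the normal components. -/
def NormalDecreaseConst (σv : ℝ) : Prop :=
  ∀ k, N.epsO < ‖Q.cBar (R.x k)‖ →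
    σv * ‖Q.jtcBar (R.x k)‖ ^ 2 ≤ ‖Q.cBar (R.x k)‖ * R.normalRed Q k

/-- `a` is a lower bound of the step sizes at iterates in `𝒳_γ`. -/
def StepLowerBound (γ a : ℝ) : Prop := ∀ k, R.x k ∈ Q.levelSet N γ → a ≤ R.alpha k

/-- All `m` singular values of every true Jacobian `J_k` are at least `κ_σ`. -/
def SingularValuesBelow (κσ : ℝ) : Prop :=
  ∀ k, ∀ i < m, κσ ≤ (Q.jac (R.x k)).toLinearMap.singularValues i

end Run

/-- Upper bound `α_u^i` of the step sizes. -/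
def alphaUpper (P : Params) : StepOption → ℝ
  | StepOption.adaptive =>
      (2 * (1 - P.eta) * P.xiInit * max P.tauInit 1 / P.Gam + P.theta) * P.beta
  | StepOption.lineSearch => P.alphaL

/-- `𝓔_c^A = 2 ε_c + α_u^A κ_d ε_J` and `𝓔_c^L = 6 ε_c + α_u^L κ_d ε_J`. -/
def errC (P : Params) (N : Noise) (κd : ℝ) : StepOption → ℝ
  | StepOption.adaptive => 2 * N.epsC + alphaUpper P StepOption.adaptive * κd * N.epsJ
  | StepOption.lineSearch => 6 * N.epsC + alphaUpper P StepOption.lineSearch * κd * N.epsJ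

/-- The size of the neighborhood, for a bound `κ_d` on the directions, a decrease constant `σ_v`,
a step size lower bound `a` and `σ_γ ∈ (0,1)`. -/
def radius (P : Params) (N : Noise) (opt : StepOption) (κd σv a σγ : ℝ) : ℝ :=
  max (N.epsC * (N.epsJ + P.kapJ) + P.kapC * N.epsJ
      + √((1 + σγ) * (P.kapC + N.epsC) * errC P N κd opt / (P.eta * a * P.sigC * σv)))
    (2 * P.kapJ * N.epsC)

end

end NoisySQP

/-! The neighborhood bounds rest on the merit parameter alone. At an infeasible iterate where the
model test fails and the trial value is finite, that value is a fixed multiple of `fullRed` divided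
by `trialDen`. Bounded directions, gradients and matrices `H k` bound `trialDen` above by a
constant. If the noisy error `‖jtcBar‖` is at least `ε`, the Cauchy condition on the normal step
bounds `normalRed` below, and the feasibility test transfers this to `fullRed`. So, while the noisy
error stays above `ε`, every decrease of the merit parameter leaves it above a fixed positive
number. A merit parameter tending to zero therefore forces the noisy error below each `ε` infinitely
often (`frequently_norm_jtcBar_lt`).

Replacing noisy by true quantities costs at most `ε_c (ε_J + κ_J) + κ_c ε_J`, which bounds the
liminf of `‖jtc‖`. This is the part of `radius` outside its square root, so `radius` dominates it.
It is also linear in the noise up to a product term, hence of order at most `√(ε_c + ε_J)` for noise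
levels up to one. A lower bound on the singular values converts the estimate of `Jᵀ c` into one of
`c`.

The constants of the first claim are explicit: the Cauchy step gives `decreaseConst`, the
termination tests give `dirBound`, and `stepBound` follows from a positive lower bound on the model
reduction over the level set. For the line search, a Taylor estimate of the noisy merit function is
also needed. -/

namespace NoisySQP

/-! ### Linear algebra, Taylor estimate and liminf -/

section General

/-- If all `m` singular values of an `m × n` matrix `A` are at
least `κ > 0`, then `κ ‖y‖ ≤ ‖Aᵀ y‖`. -/
theorem mul_norm_le_norm_tr_of_singularValues {m n : ℕ} (A : Mat m n) {κ : ℝ} (hκ : 0 < κ)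
    (h : ∀ i < m, κ ≤ A.toLinearMap.singularValues i) (y : Vec m) : κ * ‖y‖ ≤ ‖tr A y‖ := by
  have hn : Module.finrank ℝ (Vec n) = n := by simp
  set T := A.toLinearMap with hT
  -- Singular values of index at least `n` are zero by convention, so the positive lower bound
  -- forces `m ≤ n`.
  have hlt : ∀ i < m, i < n := by
    intro i hi
    by_contra hin
    have := T.singularValues_of_finrank_le (i := i) (by rw [hn]; omega)
    have := h i hi
    linarith
  have hsymm := T.isSymmetric_adjoint_comp_self
  set b := hsymm.eigenvectorBasis hn with hb
  let e : Fin m → Fin n := fun i => ⟨i, hlt i i.2⟩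
  have he : Function.Injective e := by
    intro i j hij
    simpa [e, Fin.ext_iff] using hij
  have hσ : ∀ i : Fin m, 0 < T.singularValues i := fun i => hκ.trans_le (h i i.2)
  have hinner : ∀ i (z : Vec n), ⟪A (b (e i)), A z⟫_ℝ = T.singularValues i ^ 2 * ⟪b (e i), z⟫_ℝ := by
    intro i z
    have h1 : (LinearMap.adjoint T ∘ₗ T) (b (e i)) =
        (T.singularValues i ^ 2) • b (e i) := by
      rw [hb, hsymm.apply_eigenvectorBasis hn (e i), T.sq_singularValues_of_lt hn (hlt i i.2)]
      rfl
    have h2 : ⟪(LinearMap.adjoint T ∘ₗ T) (b (e i)), z⟫_ℝ = ⟪A (b (e i)), A z⟫_ℝ := by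
      rw [LinearMap.comp_apply, LinearMap.adjoint_inner_left]
      rfl
    rw [← h2, h1, real_inner_smul_left]
  -- These are the left singular vectors. Being `m` orthonormal vectors in `ℝᵐ`, they form a basis:
  -- `‖y‖²` expands in it exactly, while Bessel's inequality suffices for the right singular
  -- vectors.
  let w : Fin m → Vec m := fun i => (T.singularValues i)⁻¹ • A (b (e i))
  have hw : Orthonormal ℝ w := by
    rw [orthonormal_iff_ite]
    intro i j
    simp only [w]
    rw [real_inner_smul_left, real_inner_smul_right, hinner,
      orthonormal_iff_ite.mp b.orthonormal (e i) (e j)]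
    have := (hσ i).ne'
    by_cases hij : i = j
    · subst hij
      simp
      field_simp
    · simp [hij, he.ne hij]
  have hspan : ⊤ ≤ Submodule.span ℝ (Set.range w) :=
    (hw.linearIndependent.span_eq_top_of_card_eq_finrank' (by simp)).ge
  let B := OrthonormalBasis.mk hw hspan
  have hBw : ∀ i, ⟪B i, y⟫_ℝ = (T.singularValues i)⁻¹ * ⟪b (e i), tr A y⟫_ℝ := by
    intro i
    rw [show B i = w i by simp [B]]
    simp only [w]
    rw [real_inner_smul_left, ContinuousLinearMap.adjoint_inner_right]
  have hbessel : ∑ i : Fin m, ‖⟪b (e i), tr A y⟫_ℝ‖ ^ 2 ≤ ‖tr A y‖ ^ 2 :=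
    (b.orthonormal.comp e he).sum_inner_products_le _
  have hterm : ∀ i : Fin m, κ ^ 2 * ‖⟪B i, y⟫_ℝ‖ ^ 2 ≤ ‖⟪b (e i), tr A y⟫_ℝ‖ ^ 2 := by
    intro i
    rw [hBw, norm_mul, mul_pow, ← mul_assoc]
    have h1 : κ ^ 2 * ‖(T.singularValues i)⁻¹‖ ^ 2 ≤ 1 := by
      rw [Real.norm_of_nonneg (inv_nonneg.2 (hσ i).le), inv_pow, ← div_eq_mul_inv,
        div_le_one (pow_pos (hσ i) 2)]
      exact pow_le_pow_left₀ hκ.le (h i i.2) 2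
    exact mul_le_of_le_one_left (by positivity) h1
  have hsq : (κ * ‖y‖) ^ 2 ≤ ‖tr A y‖ ^ 2 := by
    rw [mul_pow, ← B.sum_sq_norm_inner_right y, Finset.mul_sum]
    exact (Finset.sum_le_sum fun i _ => hterm i).trans hbessel
  exact le_of_sq_le_sq hsq (norm_nonneg _)

/-- The decrease of the linearized constraint violation along the Cauchy step. -/
theorem cauchy_step_decrease {m n : ℕ} (A : Mat m n) (c : Vec m) {σ K : ℝ}
    (hσ : 0 ≤ σ) (hK : 0 < K) (hA : ‖A‖ ≤ K) (hg : tr A c ≠ 0) :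
    min σ (1 / K ^ 2) / 2 * ‖tr A c‖ ^ 2 ≤ ‖c‖ * (‖c‖ -
      ‖c + min σ (‖tr A c‖ ^ 2 / ‖A (tr A c)‖ ^ 2) • A (-tr A c)‖) := by
  set g := tr A c with hgdef
  have hp : 0 < ‖g‖ ^ 2 := by positivity
  have hinner : ⟪c, A g⟫_ℝ = ‖g‖ ^ 2 := by
    rw [← ContinuousLinearMap.adjoint_inner_left, ← real_inner_self_eq_norm_sq]
  have hAg : A g ≠ 0 := by
    intro h0
    rw [h0, inner_zero_right] at hinner
    exact hp.ne hinner
  have hq : 0 < ‖A g‖ ^ 2 := by positivity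
  have hqK : ‖A g‖ ^ 2 ≤ K ^ 2 * ‖g‖ ^ 2 := by
    rw [← mul_pow]
    exact pow_le_pow_left₀ (norm_nonneg _) (A.le_of_opNorm_le hA g) 2
  set α := min σ (‖g‖ ^ 2 / ‖A g‖ ^ 2) with hα
  have hα1 : min σ (1 / K ^ 2) ≤ α := by
    refine min_le_min le_rfl ?_
    rw [div_le_div_iff₀ (by positivity) hq]
    linarith
  have hα2 : α * ‖A g‖ ^ 2 ≤ ‖g‖ ^ 2 := by
    rw [← le_div_iff₀ hq]
    exact min_le_right _ _
  have hα0 : 0 ≤ α := le_min hσ (by positivity)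
  have hb : ‖c + α • A (-g)‖ ^ 2 = ‖c‖ ^ 2 - 2 * α * ‖g‖ ^ 2 + α * (α * ‖A g‖ ^ 2) := by
    rw [map_neg, norm_add_sq_real, real_inner_smul_right, inner_neg_right, hinner, norm_smul,
      norm_neg, mul_pow, Real.norm_eq_abs, sq_abs]
    ring
  have h1 := mul_le_mul_of_nonneg_left hα2 hα0
  have h2 := mul_le_mul_of_nonneg_right hα1 hp.le
  -- With `b` the new norm, `2‖c‖(‖c‖ - b) ≥ ‖c‖² - b² = 2α‖g‖² - α²‖A g‖² ≥ α‖g‖²`.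
  nlinarith [sq_nonneg (‖c‖ - ‖c + α • A (-g)‖)]

/-- First order Taylor estimate for a map with Lipschitz derivative on an open convex set. -/
theorem taylor_bound {E F : Type*} [NormedAddCommGroup E] [NormedSpace ℝ E] [NormedAddCommGroup F]
    [NormedSpace ℝ F] {s : Set E} (hs : IsOpen s) (hconv : Convex ℝ s) {f : E → F}
    (hf : DifferentiableOn ℝ f s) {K : ℝ} (hK : 0 ≤ K)
    (hlip : ∀ x ∈ s, ∀ y ∈ s, ‖fderiv ℝ f x - fderiv ℝ f y‖ ≤ K * ‖x - y‖) {x y : E}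
    (hx : x ∈ s) (hy : y ∈ s) :
    ‖f y - f x - fderiv ℝ f x (y - x)‖ ≤ K * ‖y - x‖ ^ 2 := by
  have hseg := hconv.segment_subset hx hy
  -- The mean value inequality, applied to `f` minus its linearization at `x`, gives the constant
  -- `K` instead of the sharp `K / 2`; the step bound for the line search absorbs the loss.
  have := (convex_segment (𝕜 := ℝ) x y).norm_image_sub_le_of_norm_fderiv_le' (f := f)
    (φ := fderiv ℝ f x) (C := K * ‖y - x‖)
    (fun z hz => hf.differentiableAt (hs.mem_nhds (hseg hz)))
    (fun z hz => (hlip z (hseg hz) x hx).trans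
      (mul_le_mul_of_nonneg_left (norm_sub_le_of_mem_segment hz) hK))
    (left_mem_segment ℝ x y) (right_mem_segment ℝ x y)
  rwa [mul_assoc, ← sq] at this

theorem liminf_le_of_forall_frequently_le_add {f : ℕ → ℝ} {a : ℝ} (hf : ∀ k, 0 ≤ f k)
    (h : ∀ ε > 0, ∃ᶠ k in atTop, f k ≤ a + ε) : liminf f atTop ≤ a :=
  le_of_forall_pos_le_add fun ε hε =>
    liminf_le_of_frequently_le (h ε hε) (isBoundedUnder_of ⟨0, hf⟩)

end General


/-! ### Effect of the noise, and the merit function along a direction -/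

namespace Problem

variable {n m : ℕ} {Q : Problem n m} {P : Params} {N : Noise}

section Bounds

variable (hs : Q.Smooth P) (hn : Q.BoundedNoise N) {x : Vec n} (hx : x ∈ Q.dom)
include hs hn hx

theorem norm_gBar_le : ‖Q.gBar x‖ ≤ P.kapG + N.epsG := by
  have h1 := norm_le_norm_add_norm_sub' (Q.gBar x) (gradient Q.f x)
  have h2 := hs.grad_bound x hx
  have h3 := hn.g_err x hx
  linarith

theorem norm_cBar_le : ‖Q.cBar x‖ ≤ P.kapC + N.epsC := by
  have h1 := norm_le_norm_add_norm_sub' (Q.cBar x) (Q.c x)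
  have h2 := hs.c_bound x hx
  have h3 := hn.c_err x hx
  linarith

theorem norm_jBar_le : ‖Q.jBar x‖ ≤ P.kapJ + N.epsJ := by
  have h1 := norm_le_norm_add_norm_sub' (Q.jBar x) (Q.jac x)
  have h2 := hs.jac_bound x hx
  have h3 := hn.j_err x hx
  linarith

theorem norm_jtcBar_le : ‖Q.jtcBar x‖ ≤ (P.kapJ + N.epsJ) * (P.kapC + N.epsC) := by
  have hj : ‖tr (Q.jBar x)‖ ≤ P.kapJ + N.epsJ := by
    rw [LinearIsometryEquiv.norm_map]
    exact norm_jBar_le hs hn hx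
  exact (ContinuousLinearMap.le_of_opNorm_le_of_le _ hj (norm_cBar_le hs hn hx))

/-- The noise in the infeasible stationarity error. -/
theorem norm_jtc_le : ‖Q.jtc x‖ ≤
    ‖Q.jtcBar x‖ + (N.epsC * (N.epsJ + P.kapJ) + P.kapC * N.epsJ) := by
  have hj : ‖tr (Q.jBar x)‖ ≤ P.kapJ + N.epsJ := by
    rw [LinearIsometryEquiv.norm_map]
    exact norm_jBar_le hs hn hx
  have hd : ‖tr (Q.jBar x - Q.jac x)‖ ≤ N.epsJ := by
    rw [LinearIsometryEquiv.norm_map]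
    exact hn.j_err x hx
  have h1 := ContinuousLinearMap.le_of_opNorm_le_of_le _ hj (hn.c_err x hx)
  have h2 := ContinuousLinearMap.le_of_opNorm_le_of_le _ hd (hs.c_bound x hx)
  -- Splitting the error this way pairs the noisy Jacobian with the noise in `c`, and the noise in
  -- the Jacobian with the true `c`.
  have heq : Q.jtc x = Q.jtcBar x - (tr (Q.jBar x) (Q.cBar x - Q.c x) +
      tr (Q.jBar x - Q.jac x) (Q.c x)) := by
    simp only [jtc, jtcBar, tr, map_sub, sub_apply]
    abel
  rw [heq]
  have h3 := norm_sub_le (Q.jtcBar x) (tr (Q.jBar x) (Q.cBar x - Q.c x) +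
      tr (Q.jBar x - Q.jac x) (Q.c x))
  have h4 := norm_add_le (tr (Q.jBar x) (Q.cBar x - Q.c x)) (tr (Q.jBar x - Q.jac x) (Q.c x))
  linarith

end Bounds

theorem Smooth.constraint_taylor (hs : Q.Smooth P) (hΓ : 0 ≤ P.Gam) {x y : Vec n}
    (hx : x ∈ Q.dom) (hy : y ∈ Q.dom) :
    ‖Q.c y - Q.c x - Q.jac x (y - x)‖ ≤ P.Gam * ‖y - x‖ ^ 2 :=
  taylor_bound hs.dom_open hs.dom_convex (hs.c_contDiff.differentiableOn one_ne_zero) hΓ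
    hs.jac_lipschitz hx hy

theorem Smooth.objective_taylor (hs : Q.Smooth P) (hL : 0 ≤ P.L) {x y : Vec n}
    (hx : x ∈ Q.dom) (hy : y ∈ Q.dom) :
    |Q.f y - Q.f x - ⟪gradient Q.f x, y - x⟫_ℝ| ≤ P.L * ‖y - x‖ ^ 2 := by
  have h := taylor_bound hs.dom_open hs.dom_convex (hs.f_contDiff.differentiableOn one_ne_zero) hL
    (fun a ha b hb => by
      rw [← toDual_gradient, ← toDual_gradient, ← map_sub, LinearIsometryEquiv.norm_map]
      exact hs.grad_lipschitz a ha b hb) hx hy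
  rwa [← toDual_gradient, InnerProductSpace.toDual_apply_apply, Real.norm_eq_abs] at h

theorem norm_model_add_smul_le (x d : Vec n) {a : ℝ} (ha0 : 0 ≤ a) (ha1 : a ≤ 1) :
    ‖Q.cBar x + a • Q.jBar x d‖ ≤ (1 - a) * ‖Q.cBar x‖ + a * ‖Q.cBar x + Q.jBar x d‖ := by
  have heq : Q.cBar x + a • Q.jBar x d = (1 - a) • Q.cBar x + a • (Q.cBar x + Q.jBar x d) := by
    module
  rw [heq]
  refine (norm_add_le _ _).trans ?_
  rw [norm_smul, norm_smul, Real.norm_of_nonneg ha0, Real.norm_of_nonneg (sub_nonneg.2 ha1)]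

/-- The change of the noisy merit function along a direction, in terms of its model. -/
theorem meritBar_add_smul_le (hs : Q.Smooth P) (hn : Q.BoundedNoise N) (hL : 0 ≤ P.L)
    (hΓ : 0 ≤ P.Gam) {x d : Vec n} (hx : x ∈ Q.dom) (hxd : x + d ∈ Q.dom) {a τ : ℝ} (hτ : 0 ≤ τ)
    (ha0 : 0 ≤ a) (ha1 : a ≤ 1) :
    Q.meritBar (x + a • d) τ ≤ Q.meritBar x τ - a * Q.modelRed x τ d
      + (2 * τ * N.epsF + 4 * N.epsC + τ * a * N.epsG * ‖d‖ + a * N.epsJ * ‖d‖)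
      + (τ * P.L + P.Gam) * (a * ‖d‖) ^ 2 := by
  have hy : x + a • d ∈ Q.dom := hs.dom_convex.add_smul_mem hx hxd ⟨ha0, ha1⟩
  have hnorm : ‖a • d‖ = a * ‖d‖ := by rw [norm_smul, Real.norm_of_nonneg ha0]
  have hf := hs.objective_taylor hL hx hy
  have hc := hs.constraint_taylor hΓ hx hy
  rw [add_sub_cancel_left, hnorm] at hf hc
  rw [real_inner_smul_right] at hf
  rw [map_smul] at hc
  have hfy := hn.f_err _ hy
  have hfx := hn.f_err _ hx
  have hcy := hn.c_err _ hy
  have hcx := hn.c_err _ hx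
  have hg : |⟪Q.gBar x - gradient Q.f x, d⟫_ℝ| ≤ N.epsG * ‖d‖ :=
    (abs_real_inner_le_norm _ _).trans
      (mul_le_mul_of_nonneg_right (hn.g_err x hx) (norm_nonneg d))
  have hj : ‖(Q.jBar x - Q.jac x) d‖ ≤ N.epsJ * ‖d‖ :=
    ContinuousLinearMap.le_of_opNorm_le _ (hn.j_err x hx) d
  have hj' : ‖a • (Q.jBar x - Q.jac x) d‖ ≤ a * (N.epsJ * ‖d‖) := by
    rw [norm_smul, Real.norm_of_nonneg ha0]
    exact mul_le_mul_of_nonneg_left hj ha0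
  have hmodel := norm_model_add_smul_le (Q := Q) x d ha0 ha1
  rw [inner_sub_left] at hg
  -- The pieces are the constraint noise at both endpoints, the Taylor remainder, the Jacobian noise
  -- along the step, and the noisy linear model.
  have hcsplit : Q.cBar (x + a • d) = (Q.cBar (x + a • d) - Q.c (x + a • d))
      + (Q.c (x + a • d) - Q.c x - a • Q.jac x d) - (Q.cBar x - Q.c x)
      - a • (Q.jBar x - Q.jac x) d + (Q.cBar x + a • Q.jBar x d) := by
    rw [sub_apply]
    module
  have hcnorm : ‖Q.cBar (x + a • d)‖ ≤ N.epsC + P.Gam * (a * ‖d‖) ^ 2 + N.epsC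
      + a * (N.epsJ * ‖d‖) + ((1 - a) * ‖Q.cBar x‖ + a * ‖Q.cBar x + Q.jBar x d‖) := by
    rw [hcsplit]
    refine (norm_add_le _ _).trans (add_le_add ?_ hmodel)
    refine (norm_sub_le _ _).trans (add_le_add ?_ hj')
    refine (norm_sub_le _ _).trans (add_le_add ?_ hcx)
    exact (norm_add_le _ _).trans (add_le_add hcy hc)
  have hfbound : Q.fBar (x + a • d) ≤ Q.fBar x + a * ⟪Q.gBar x, d⟫_ℝ + 2 * N.epsF
      + a * (N.epsG * ‖d‖) + P.L * (a * ‖d‖) ^ 2 := by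
    have h1 := (abs_le.1 hf).2
    have h2 := (abs_le.1 hfy).2
    have h3 := (abs_le.1 hfx).1
    have h4 := mul_le_mul_of_nonneg_left (abs_le.1 hg).1 ha0
    linarith
  have hτf := mul_le_mul_of_nonneg_left hfbound hτ
  -- Only `2 ε_c` arises above; nonnegativity of `ε_c` enlarges it to the `4 ε_c` of the line search
  -- relaxation.
  have hε := (norm_nonneg _).trans hcx
  simp only [meritBar, modelRed]
  linarith

end Problem

/-! ### Algebra of the merit parameter update -/

namespace Run

variable {n m : ℕ} {Q : Problem n m} {P : Params} {N : Noise} {R : Run n m} {opt : StepOption}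

theorem maxCurv_nonneg (hP : P.Admissible opt) (k : ℕ) : 0 ≤ R.maxCurv P k :=
  le_max_of_le_right (mul_nonneg hP.lamU_mem.1.le (sq_nonneg _))

theorem modelRed_eq_sub_fullRed (hG : R.Generated P N Q opt) (k : ℕ) (τ : ℝ) :
    Q.modelRed (R.x k) τ (R.d k) = -τ * ⟪Q.gBar (R.x k), R.d k⟫_ℝ + R.fullRed Q k := by
  simp only [Problem.modelRed, fullRed, r, hG.direction k, map_add]
  rw [add_assoc (Q.cBar (R.x k))]
  ring

/-- A model reduction condition holds for every small enough merit parameter. -/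
theorem le_modelRed_of_mul_trialDen_le (hP : P.Admissible opt) (hG : R.Generated P N Q opt) (k : ℕ)
    (hF : R.FeasTest P Q k) {τ : ℝ} (hτ : 0 ≤ τ)
    (hden : τ * R.trialDen P Q k ≤ (1 - P.sigC / P.sigR) * R.fullRed Q k) :
    τ * P.sigU * R.maxCurv P k + P.sigC * R.normalRed Q k
      ≤ Q.modelRed (R.x k) τ (R.d k) := by
  rw [modelRed_eq_sub_fullRed hG]
  have hM := maxCurv_nonneg (R := R) hP k
  have hr : 0 < P.sigR := hP.sigC_mem.1.trans hP.sigR_mem.1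
  -- The fraction `σ_c / σ_r` of `fullRed` covers the normal decrease; the remaining fraction pays
  -- for `τ * trialDen`.
  have h1 : P.sigC * R.normalRed Q k ≤ P.sigC / P.sigR * R.fullRed Q k := by
    have := mul_le_mul_of_nonneg_left hF.1 (div_nonneg hP.sigC_mem.1.le hr.le)
    rwa [← mul_assoc, div_mul_cancel₀ _ hr.ne'] at this
  have h2 : τ * P.sigU * R.maxCurv P k ≤ τ * R.maxCurv P k :=
    mul_le_mul_of_nonneg_right (mul_le_of_le_one_right hτ hP.sigU_mem.2.le) hM
  simp only [trialDen] at hden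
  linarith

theorem FeasTest.normalRed_pos (hP : P.Admissible opt) {k : ℕ} (hF : R.FeasTest P Q k) :
    0 < R.normalRed Q k :=
  pos_of_mul_pos_right hF.2 (hP.sigC_mem.1.trans hP.sigR_mem.1).le

theorem FeasTest.fullRed_pos {k : ℕ} (hF : R.FeasTest P Q k) : 0 < R.fullRed Q k :=
  hF.2.trans_le hF.1

theorem one_sub_sigC_div_sigR_pos (hP : P.Admissible opt) : 0 < 1 - P.sigC / P.sigR :=
  sub_pos.2 ((div_lt_one (hP.sigC_mem.1.trans hP.sigR_mem.1)).2 hP.sigR_mem.1)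

end Run


/-! ### Explicit constants -/

/-- The constant `σ_v` of sufficient linearized decrease. -/
noncomputable def decreaseConst (P : Params) (N : Noise) : ℝ :=
  P.gamC * (min P.sigJc (1 / (P.kapJ + N.epsJ) ^ 2) / 2)

/-- A bound of the normal components `v̄_k`. -/
noncomputable def normalBound (P : Params) (N : Noise) : ℝ :=
  P.sigJc * ((P.kapJ + N.epsJ) * (P.kapC + N.epsC))

/-- A bound of the tangential components `ū_k`. -/
noncomputable def tangentialBound (P : Params) (N : Noise) : ℝ :=
  1 + P.lamUV * normalBound P N + (2 / P.lamU) * (3 / 2 * N.epsO + P.lamV * normalBound P N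
    + (P.kapG + N.epsG) + P.kapH * normalBound P N)

/-- The bound `κ_d` of the directions `d̄_k`. -/
noncomputable def dirBound (P : Params) (N : Noise) : ℝ := normalBound P N + tangentialBound P N

/-- A lower bound of the model reduction at iterates in `𝒳_γ`. -/
noncomputable def modelRedBound (P : Params) (N : Noise) (γ : ℝ) : ℝ :=
  P.sigC * (decreaseConst P N * γ ^ 2 / (P.kapC + N.epsC))

/-- The lower bound of the step sizes at iterates in `𝒳_γ`. -/
noncomputable def stepBound (P : Params) (N : Noise) (γ : ℝ) : StepOption → ℝ
  | StepOption.adaptive => min (P.theta * P.beta) (min (2 * (1 - P.eta) * P.beta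
      * modelRedBound P N γ / ((P.tauInit * P.L + P.Gam) * dirBound P N ^ 2)) 1)
  | StepOption.lineSearch => min P.alphaL (P.nu * ((1 - P.eta) * modelRedBound P N γ
      / ((P.tauInit * P.L + P.Gam) * dirBound P N ^ 2)))

section Positivity

variable {P : Params} {N : Noise} {opt : StepOption}

theorem decreaseConst_pos (hP : P.Admissible opt) (hN : N.Admissible) : 0 < decreaseConst P N := by
  have h1 := hP.kapJ_pos
  have h2 := hN.epsJ_nonneg
  have h3 := hP.sigJc_pos
  have h4 := hP.gamC_mem.1
  exact mul_pos h4 (half_pos (lt_min h3 (by positivity)))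

theorem normalBound_nonneg (hP : P.Admissible opt) (hN : N.Admissible) : 0 ≤ normalBound P N := by
  have h1 := hP.kapJ_pos
  have h2 := hN.epsJ_nonneg
  have h3 := hP.sigJc_pos
  have h4 := hP.kapC_pos
  have h5 := hN.epsC_nonneg
  unfold normalBound
  positivity

theorem tangentialBound_pos (hP : P.Admissible opt) (hN : N.Admissible) :
    0 < tangentialBound P N := by
  have h1 := hP.lamUV_pos
  have h2 := normalBound_nonneg hP hN
  have h3 := hP.lamU_mem.1
  have h4 := hN.epsO_mem.1
  have h5 := hP.lamV_pos
  have h6 := hP.kapG_pos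
  have h7 := hN.epsG_nonneg
  have h8 := hP.kapH_pos
  unfold tangentialBound
  positivity

theorem dirBound_pos (hP : P.Admissible opt) (hN : N.Admissible) : 0 < dirBound P N :=
  add_pos_of_nonneg_of_pos (normalBound_nonneg hP hN) (tangentialBound_pos hP hN)

theorem modelRedBound_pos (hP : P.Admissible opt) (hN : N.Admissible) {γ : ℝ} (hγ : 0 < γ) :
    0 < modelRedBound P N γ := by
  have h1 := hP.sigC_mem.1
  have h2 := decreaseConst_pos hP hN
  have h3 := hP.kapC_pos
  have h4 := hN.epsC_nonneg
  unfold modelRedBound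
  positivity

theorem lipschitzConst_pos (hP : P.Admissible opt) {τ : ℝ} (hτ : 0 < τ) : 0 < τ * P.L + P.Gam :=
  add_pos_of_pos_of_nonneg (mul_pos hτ hP.L_pos) hP.Gam_nonneg

theorem stepBound_pos (hP : P.Admissible opt) (hN : N.Admissible) {γ : ℝ} (hγ : 0 < γ)
    (i : StepOption) : 0 < stepBound P N γ i := by
  have h1 := modelRedBound_pos hP hN hγ
  have h2 := lipschitzConst_pos hP hP.tauInit_pos
  have h3 := dirBound_pos hP hN
  have h4 : 0 < 1 - P.eta := sub_pos.2 hP.eta_mem.2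
  have h5 := hP.beta_mem.1
  have h6 := hP.theta_pos
  have h7 := hP.alphaL_mem.1
  have h8 := hP.nu_mem.1
  cases i
  · exact lt_min (by positivity) (lt_min (by positivity) one_pos)
  · exact lt_min h7 (by positivity)

end Positivity

/-- A quadratic inequality with positive leading coefficient bounds its variable. -/
theorem le_one_add_of_mul_sq_le {a b c t : ℝ} (ha : 0 < a) (hb : 0 ≤ b) (hc : 0 ≤ c)
    (h : a * t ^ 2 ≤ b + c * t) : t ≤ 1 + (b + c) / a := by
  by_contra hlt
  push Not at hlt
  have ht : 1 < t := by
    have : 0 ≤ (b + c) / a := by positivity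
    linarith
  have h1 : (b + c) / a < t := by linarith
  rw [div_lt_iff₀ ha] at h1
  nlinarith

/-! ### Bounds on the steps, the merit parameter and the model reduction -/

namespace Run

variable {n m : ℕ} {Q : Problem n m} {P : Params} {N : Noise} {R : Run n m} {opt : StepOption}

theorem Standing.normalDecreaseConst (hP : P.Admissible opt) (hN : N.Admissible)
    (hS : R.Standing P N Q opt) : R.NormalDecreaseConst N Q (decreaseConst P N) := by
  intro k hk
  have hx := hS.iterates_mem k
  have hK : 0 < P.kapJ + N.epsJ := add_pos_of_pos_of_nonneg hP.kapJ_pos hN.epsJ_nonneg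
  have h1 := cauchy_step_decrease (Q.jBar (R.x k)) (Q.cBar (R.x k)) hP.sigJc_pos.le hK
    (Problem.norm_jBar_le hS.smooth hS.noise hx)
    (hS.noTermination.not_infeasible_stationary k hk)
  have h2 := mul_le_mul_of_nonneg_left (hS.generated.infeasible k hk).1.cauchy_decrease
    (norm_nonneg (Q.cBar (R.x k)))
  have h3 := mul_le_mul_of_nonneg_left h1 hP.gamC_mem.1.le
  refine le_trans ?_ h2
  rw [decreaseConst, mul_assoc, mul_left_comm ‖Q.cBar (R.x k)‖]
  exact h3

theorem Standing.normalRed_pos (hP : P.Admissible opt) (hN : N.Admissible)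
    (hS : R.Standing P N Q opt) {k : ℕ} (hk : N.epsO < ‖Q.cBar (R.x k)‖) :
    0 < R.normalRed Q k := by
  have h1 := hS.normalDecreaseConst hP hN k hk
  have h2 := norm_pos_iff.2 (hS.noTermination.not_infeasible_stationary k hk)
  have h3 := decreaseConst_pos hP hN
  exact pos_of_mul_pos_right (lt_of_lt_of_le (by positivity) h1) (norm_nonneg _)

theorem Standing.norm_v_le (hP : P.Admissible opt) (hN : N.Admissible)
    (hS : R.Standing P N Q opt) (k : ℕ) : ‖R.v k‖ ≤ normalBound P N := by
  by_cases hk : ‖Q.cBar (R.x k)‖ ≤ N.epsO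
  · rw [(hS.generated.feasible k hk).1, norm_zero]
    exact normalBound_nonneg hP hN
  · exact (hS.generated.infeasible k (not_le.1 hk)).1.trust_region.trans
      (mul_le_mul_of_nonneg_left (Problem.norm_jtcBar_le hS.smooth hS.noise (hS.iterates_mem k))
        hP.sigJc_pos.le)

/-- Either `ū_k` is controlled directly by `v̄_k`, or curvature and descent combine into a quadratic
inequality in `‖ū_k‖` with leading coefficient `λ_u / 2`. -/
theorem Standing.norm_u_le (hP : P.Admissible opt) (hN : N.Admissible)
    (hS : R.Standing P N Q opt) (k : ℕ) : ‖R.u k‖ ≤ tangentialBound P N := by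
  have hV := normalBound_nonneg hP hN
  have hv := hS.norm_v_le hP hN k
  have hg := Problem.norm_gBar_le hS.smooth hS.noise (hS.iterates_mem k)
  have hU := hP.lamU_mem.1
  have hUV := hP.lamUV_pos
  have hlV := hP.lamV_pos
  have hG := hP.kapG_pos
  have hεG := hN.epsG_nonneg
  have hH := hP.kapH_pos
  have hO := hN.epsO_mem.1
  have key : ∀ b c : ℝ, 0 ≤ b → 0 ≤ c → P.lamU / 2 * ‖R.u k‖ ^ 2 ≤ b + c * ‖R.u k‖ →
      b + c ≤ 3 / 2 * N.epsO + P.lamV * normalBound P N + (P.kapG + N.epsG)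
        + P.kapH * normalBound P N → ‖R.u k‖ ≤ tangentialBound P N := by
    intro b c hb hc h hbc
    have h1 := le_one_add_of_mul_sq_le (half_pos hU) hb hc h
    have h2 : (b + c) / (P.lamU / 2) = 2 / P.lamU * (b + c) := by field_simp
    have h3 := mul_le_mul_of_nonneg_left hbc (div_nonneg zero_le_two hU.le)
    have h4 := mul_nonneg hUV.le hV
    rw [h2] at h1
    unfold tangentialBound
    linarith
  by_cases hk : ‖Q.cBar (R.x k)‖ ≤ N.epsO
  · obtain ⟨-, -, hT⟩ := hS.generated.feasible k hk
    have h1 := hT.curvature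
    have h2 := hT.descent
    have h3 := (abs_le.1 (abs_real_inner_le_norm (Q.gBar (R.x k)) (R.u k))).1
    have h4 := mul_le_mul_of_nonneg_right hg (norm_nonneg (R.u k))
    -- One `ε_o` comes from the descent condition and one half from the relaxed curvature condition.
    refine key (3 / 2 * N.epsO) (P.kapG + N.epsG) (by positivity) (by positivity) (by linarith) ?_
    have := mul_nonneg hlV.le hV
    have := mul_nonneg hH.le hV
    linarith
  · obtain ⟨-, hT, -, -⟩ := hS.generated.infeasible k (not_le.1 hk)
    rcases hT.tangential with h | ⟨h1, h2⟩
    · refine h.trans ((mul_le_mul_of_nonneg_left hv hUV.le).trans ?_)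
      unfold tangentialBound
      have : 0 ≤ (2 / P.lamU) * (3 / 2 * N.epsO + P.lamV * normalBound P N
        + (P.kapG + N.epsG) + P.kapH * normalBound P N) := by positivity
      linarith
    · have hHv : ‖R.H k (R.v k)‖ ≤ P.kapH * normalBound P N :=
        ContinuousLinearMap.le_of_opNorm_le_of_le _ (hS.hessian.bound k) hv
      have hgH := (norm_add_le (Q.gBar (R.x k)) (R.H k (R.v k))).trans (add_le_add hg hHv)
      have h3 := (abs_le.1 (abs_real_inner_le_norm
        (Q.gBar (R.x k) + R.H k (R.v k)) (R.u k))).1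
      have h4 := mul_le_mul_of_nonneg_right hgH (norm_nonneg (R.u k))
      have hcurv : 0 ≤ R.curv k := le_trans (by positivity) h1
      -- Nonnegative curvature allows its variable coefficient to be replaced by `1 / 2`.
      have h5 := mul_le_mul_of_nonneg_right
        (le_max_left (1 / 2) (1 - ‖Q.jtcBar (R.x k)‖)) hcurv
      have h6 := mul_le_mul_of_nonneg_left hv hlV.le
      refine key (P.lamV * normalBound P N) (P.kapG + N.epsG + P.kapH * normalBound P N)
        (by positivity) (by positivity) (by linarith) (by linarith)

theorem Standing.norm_d_le (hP : P.Admissible opt) (hN : N.Admissible)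
    (hS : R.Standing P N Q opt) (k : ℕ) : ‖R.d k‖ ≤ dirBound P N := by
  rw [hS.generated.direction k]
  exact (norm_add_le _ _).trans (add_le_add (hS.norm_v_le hP hN k) (hS.norm_u_le hP hN k))

/-- The possible updates of the merit parameter. -/
theorem Standing.tau_succ_cases (hS : R.Standing P N Q opt) (k : ℕ) :
    R.tau (k + 1) = R.tau k ∨
      (N.epsO < ‖Q.cBar (R.x k)‖ ∧ R.FeasTest P Q k ∧ 0 < R.trialDen P Q k ∧
        R.tau (k + 1) = (1 - P.sigTau) * R.tauTrial P Q k ∧ R.tau (k + 1) < R.tau k) := by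
  by_cases hk : ‖Q.cBar (R.x k)‖ ≤ N.epsO
  · exact Or.inl (hS.generated.feasible k hk).2.1
  · rw [not_le] at hk
    obtain ⟨-, hT, hM, hM'⟩ := hS.generated.infeasible k hk
    by_cases hmodel : R.ModelTest P Q k
    · exact Or.inl (hM hmodel)
    · rw [hM' hmodel]
      unfold tauUpdated
      split_ifs with h1 h2
      · exact Or.inl rfl
      · exact Or.inl rfl
      · exact Or.inr ⟨hk, hT.reduction.resolve_left hmodel, not_le.1 h1, rfl, not_le.1 h2⟩

theorem tauTrial_pos (hP : P.Admissible opt) {k : ℕ} (hF : R.FeasTest P Q k)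
    (hden : 0 < R.trialDen P Q k) : 0 < R.tauTrial P Q k :=
  div_pos (mul_pos (one_sub_sigC_div_sigR_pos hP) hF.fullRed_pos) hden

theorem Standing.tau_pos (hP : P.Admissible opt) (hS : R.Standing P N Q opt) (k : ℕ) :
    0 < R.tau k := by
  induction k with
  | zero => rw [hS.generated.tau_init]; exact hP.tauInit_pos
  | succ k ih =>
    rcases hS.tau_succ_cases k with h | ⟨-, hF, hden, h, -⟩
    · rwa [h]
    · rw [h]
      exact mul_pos (sub_pos.2 hP.sigTau_mem.2) (tauTrial_pos hP hF hden)

theorem Standing.tau_le_tauInit (hS : R.Standing P N Q opt) (k : ℕ) : R.tau k ≤ P.tauInit := by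
  induction k with
  | zero => exact hS.generated.tau_init.le
  | succ k ih =>
    rcases hS.tau_succ_cases k with h | ⟨-, -, -, -, h⟩
    · rwa [h]
    · exact h.le.trans ih

/-- The model reduction condition holds with the updated merit parameter. -/
theorem Standing.le_modelRedAt (hP : P.Admissible opt) (hS : R.Standing P N Q opt) {k : ℕ}
    (hk : N.epsO < ‖Q.cBar (R.x k)‖) :
    R.tau (k + 1) * P.sigU * R.maxCurv P k + P.sigC * R.normalRed Q k ≤ R.modelRedAt Q k := by
  obtain ⟨-, hT, hM, hM'⟩ := hS.generated.infeasible k hk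
  by_cases hmodel : R.ModelTest P Q k
  · unfold modelRedAt
    rw [hM hmodel]
    exact hmodel
  · have hF := hT.reduction.resolve_left hmodel
    refine le_modelRed_of_mul_trialDen_le hP hS.generated k hF (hS.tau_pos hP _).le ?_
    have hnum : 0 ≤ (1 - P.sigC / P.sigR) * R.fullRed Q k :=
      (mul_pos (one_sub_sigC_div_sigR_pos hP) hF.fullRed_pos).le
    by_cases hden : R.trialDen P Q k ≤ 0
    · exact (mul_nonpos_of_nonneg_of_nonpos (hS.tau_pos hP _).le hden).trans hnum
    · rw [← le_div_iff₀ (not_le.1 hden)]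
      have htrial := (tauTrial_pos hP hF (not_le.1 hden)).le
      have hle : (1 - P.sigTau) * R.tauTrial P Q k ≤ R.tauTrial P Q k :=
        mul_le_of_le_one_left htrial (by linarith [hP.sigTau_mem.1])
      rw [hM' hmodel]
      unfold tauUpdated
      rw [if_neg hden]
      split_ifs with h
      · exact h.trans hle
      · exact hle

theorem Standing.sigC_mul_normalRed_le (hP : P.Admissible opt) (hS : R.Standing P N Q opt) {k : ℕ}
    (hk : N.epsO < ‖Q.cBar (R.x k)‖) : P.sigC * R.normalRed Q k ≤ R.modelRedAt Q k := by
  have h1 := hS.le_modelRedAt hP hk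
  have h2 := mul_nonneg (mul_nonneg (hS.tau_pos hP (k + 1)).le hP.sigU_mem.1.le)
    (maxCurv_nonneg (R := R) hP k)
  linarith

/-- At feasible iterates positivity is exactly nontermination; at infeasible ones it comes from the
normal decrease. -/
theorem Standing.modelRedAt_pos (hP : P.Admissible opt) (hN : N.Admissible)
    (hS : R.Standing P N Q opt) (k : ℕ) : 0 < R.modelRedAt Q k := by
  by_cases hk : ‖Q.cBar (R.x k)‖ ≤ N.epsO
  · exact hN.epsO_mem.1.trans_lt (hS.noTermination.not_stationary k hk)
  · exact (mul_pos hP.sigC_mem.1 (hS.normalRed_pos hP hN (not_le.1 hk))).trans_le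
      (hS.sigC_mul_normalRed_le hP (not_le.1 hk))

theorem Standing.le_normalRed (hP : P.Admissible opt) (hN : N.Admissible)
    (hS : R.Standing P N Q opt) {γ : ℝ} (hγ : 0 < γ) {k : ℕ}
    (hk : R.x k ∈ Q.levelSet N γ) :
    decreaseConst P N * γ ^ 2 / (P.kapC + N.epsC) ≤ R.normalRed Q k := by
  have h1 := hS.normalDecreaseConst hP hN k hk.2
  have h2 := Problem.norm_cBar_le hS.smooth hS.noise (hS.iterates_mem k)
  have h3 := (hS.normalRed_pos hP hN hk.2).le
  rw [div_le_iff₀ (add_pos_of_pos_of_nonneg hP.kapC_pos hN.epsC_nonneg)]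
  have h4 := mul_le_mul_of_nonneg_left (pow_le_pow_left₀ hγ.le hk.1 2)
    (decreaseConst_pos hP hN).le
  have h5 := mul_le_mul_of_nonneg_right h2 h3
  linarith

theorem Standing.modelRedBound_le (hP : P.Admissible opt) (hN : N.Admissible)
    (hS : R.Standing P N Q opt) {γ : ℝ} (hγ : 0 < γ) {k : ℕ}
    (hk : R.x k ∈ Q.levelSet N γ) : modelRedBound P N γ ≤ R.modelRedAt Q k :=
  (mul_le_mul_of_nonneg_left (hS.le_normalRed hP hN hγ hk) hP.sigC_mem.1.le).trans
    (hS.sigC_mul_normalRed_le hP hk.2)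

/-- A zero direction has zero model reduction. Nonvanishing makes the quotients by `‖d̄_k‖²` in
Option I genuine. -/
theorem Standing.d_ne_zero (hP : P.Admissible opt) (hN : N.Admissible)
    (hS : R.Standing P N Q opt) (k : ℕ) : R.d k ≠ 0 := by
  intro h
  have := hS.modelRedAt_pos hP hN k
  simp [modelRedAt, Problem.modelRed, h] at this

/-! ### Lower bounds for the step sizes -/

theorem Standing.lipschitz_mul_sq_le (hP : P.Admissible opt) (hN : N.Admissible)
    (hS : R.Standing P N Q opt) (k : ℕ) : (R.tau (k + 1) * P.L + P.Gam) * ‖R.d k‖ ^ 2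
      ≤ (P.tauInit * P.L + P.Gam) * dirBound P N ^ 2 := by
  have h1 := mul_le_mul_of_nonneg_right (hS.tau_le_tauInit (k + 1)) hP.L_pos.le
  have h2 := pow_le_pow_left₀ (norm_nonneg _) (hS.norm_d_le hP hN k) 2
  exact mul_le_mul (by linarith) h2 (sq_nonneg _) (lipschitzConst_pos hP hP.tauInit_pos).le

theorem AdaptiveSteps.xi_pos (hP : P.Admissible opt) (hN : N.Admissible)
    (hS : R.Standing P N Q opt) {S : Aux} (hA : R.AdaptiveSteps P Q S) (k : ℕ) : 0 < S.xi k := by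
  induction k with
  | zero => rw [hA.xi_init]; exact hP.xiInit_pos
  | succ k ih =>
    have hδ := hS.modelRedAt_pos hP hN k
    have hd := norm_pos_iff.2 (hS.d_ne_zero hP hN k)
    have hτ := hS.tau_pos hP (k + 1)
    have htrial : 0 < R.xiTrial Q S k := by
      unfold xiTrial
      split_ifs <;> positivity
    rw [hA.xi_update]
    split_ifs
    · exact ih
    · exact lt_min (mul_pos (sub_pos.2 hP.sigXi_mem.2) ih) htrial

/-- The projection is at least the minimum of `alphaMax` and `alphaSuff`, and `alphaMax` is at least
`θ β` because `alphaMin` is nonnegative. Positivity of `ξ̄_k` is enough; no uniform lower bound on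
it is needed. -/
theorem AdaptiveSteps.stepLowerBound (hP : P.Admissible opt) (hN : N.Admissible)
    (hS : R.Standing P N Q opt) {S : Aux} (hA : R.AdaptiveSteps P Q S) {γ : ℝ} (hγ : 0 < γ) :
    R.StepLowerBound N Q γ (stepBound P N γ StepOption.adaptive) := by
  intro k hk
  have hξ := hA.xi_pos hP hN hS (k + 1)
  have hτ := hS.tau_pos hP (k + 1)
  have hLip := lipschitzConst_pos hP hτ
  have hη : 0 < 1 - P.eta := sub_pos.2 hP.eta_mem.2
  have hβ := hP.beta_mem.1
  have hd := norm_pos_iff.2 (hS.d_ne_zero hP hN k)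
  have hmin : 0 ≤ R.alphaMin P S k := by
    unfold alphaMin
    split_ifs <;> positivity
  rw [hA.step]
  refine le_max_of_le_right (min_le_min ?_ (min_le_min_right _ ?_))
  · unfold alphaMax
    linarith
  · have hδ := hS.modelRedBound_le hP hN hγ hk
    have hδ0 := modelRedBound_pos hP hN hγ
    have hden := hS.lipschitz_mul_sq_le hP hN k
    exact div_le_div₀ (by have := hS.modelRedAt_pos hP hN k; positivity)
      (mul_le_mul_of_nonneg_left hδ (by positivity)) (by positivity) hden

/-- The relaxed Armijo condition holds for every small enough step size. -/
theorem Standing.armijo (hP : P.Admissible opt) (hN : N.Admissible)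
    (hS : R.Standing P N Q opt) {γ : ℝ} (hγ : 0 < γ) {k : ℕ} (hk : R.x k ∈ Q.levelSet N γ)
    {a : ℝ} (ha0 : 0 ≤ a) (ha1 : a ≤ P.alphaL)
    (ha : a ≤ (1 - P.eta) * modelRedBound P N γ
      / ((P.tauInit * P.L + P.Gam) * dirBound P N ^ 2)) : R.Armijo P N Q k a := by
  have hτ := (hS.tau_pos hP (k + 1)).le
  have h1 := Problem.meritBar_add_smul_le hS.smooth hS.noise hP.L_pos.le hP.Gam_nonneg
    (hS.iterates_mem k) (hS.trial_mem k) hτ ha0 (ha1.trans hP.alphaL_mem.2)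
  have hδ := hS.modelRedBound_le hP hN hγ hk
  have hη : 0 ≤ 1 - P.eta := (sub_pos.2 hP.eta_mem.2).le
  have hLip := lipschitzConst_pos hP hP.tauInit_pos
  have hD := dirBound_pos hP hN
  rw [le_div_iff₀ (by positivity)] at ha
  have hden := hS.lipschitz_mul_sq_le hP hN k
  -- The second-order remainder is absorbed by the share `1 - η` of the model reduction that the
  -- Armijo condition leaves free.
  have h2 : a * (a * ((R.tau (k + 1) * P.L + P.Gam) * ‖R.d k‖ ^ 2))
      ≤ a * ((1 - P.eta) * R.modelRedAt Q k) :=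
    mul_le_mul_of_nonneg_left ((mul_le_mul_of_nonneg_left hden ha0).trans
      (ha.trans (mul_le_mul_of_nonneg_left hδ hη))) ha0
  have h3 : R.tau (k + 1) * a * N.epsG * ‖R.d k‖ ≤ R.tau (k + 1) * P.alphaL * N.epsG * ‖R.d k‖ := by
    have := hN.epsG_nonneg
    gcongr
  have h4 : a * N.epsJ * ‖R.d k‖ ≤ P.alphaL * N.epsJ * ‖R.d k‖ := by
    have := hN.epsJ_nonneg
    gcongr
  unfold Armijo relaxation
  unfold modelRedAt at h2 ⊢
  linarith

/-- Either the initial step size is accepted, or the last rejected one exceeds the threshold that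
guarantees the Armijo condition, and the accepted one is `ν` times it. -/
theorem LineSearchSteps.stepLowerBound (hP : P.Admissible opt) (hN : N.Admissible)
    (hS : R.Standing P N Q opt) (hA : R.LineSearchSteps P N Q) {γ : ℝ} (hγ : 0 < γ) :
    R.StepLowerBound N Q γ (stepBound P N γ StepOption.lineSearch) := by
  intro k hk
  obtain ⟨j, hj, -, hfail⟩ := hA k
  rw [hj]
  cases j with
  | zero => simp [stepBound]
  | succ i =>
    refine min_le_of_right_le ?_
    have hν := hP.nu_mem.1
    have hα := hP.alphaL_mem.1
    have hlt := mt (hS.armijo hP hN hγ hk (a := P.alphaL * P.nu ^ i) (by positivity)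
      (mul_le_of_le_one_right hα.le (pow_le_one₀ hν.le hP.nu_mem.2.le))) (hfail i i.lt_succ_self)
    rw [pow_succ P.nu, ← mul_assoc, mul_comm (P.alphaL * P.nu ^ i)]
    exact mul_le_mul_of_nonneg_left (not_le.1 hlt).le hν.le

theorem Standing.stepLowerBound (hP : P.Admissible opt) (hN : N.Admissible)
    (hS : R.Standing P N Q opt) {γ : ℝ} (hγ : 0 < γ) :
    R.StepLowerBound N Q γ (stepBound P N γ opt) := by
  have hsteps := hS.generated.stepSize
  cases opt
  · obtain ⟨S, hA⟩ := hsteps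
    exact hA.stepLowerBound hP hN hS hγ
  · exact LineSearchSteps.stepLowerBound hP hN hS hsteps hγ

/-! ### Consequences of a vanishing merit parameter -/

theorem Standing.trialDen_le (hP : P.Admissible opt) (hN : N.Admissible)
    (hS : R.Standing P N Q opt) (k : ℕ) : R.trialDen P Q k ≤
      (P.kapG + N.epsG) * dirBound P N + (P.kapH + P.lamU) * tangentialBound P N ^ 2 := by
  have hu := hS.norm_u_le hP hN k
  have hg := Problem.norm_gBar_le hS.smooth hS.noise (hS.iterates_mem k)
  have hG : 0 ≤ P.kapG + N.epsG := (norm_nonneg _).trans hg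
  have h1 : ⟪Q.gBar (R.x k), R.d k⟫_ℝ ≤ (P.kapG + N.epsG) * dirBound P N :=
    (real_inner_le_norm _ _).trans
      (mul_le_mul hg (hS.norm_d_le hP hN k) (norm_nonneg _) hG)
  have h2 := pow_le_pow_left₀ (norm_nonneg _) hu 2
  have hcurv : R.curv k ≤ P.kapH * ‖R.u k‖ ^ 2 := by
    refine (real_inner_le_norm _ _).trans ?_
    have := mul_le_mul_of_nonneg_left
      (ContinuousLinearMap.le_of_opNorm_le _ (hS.hessian.bound k) (R.u k)) (norm_nonneg (R.u k))
    linarith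
  have hH := hP.kapH_pos
  have hU := hP.lamU_mem.1
  have h3 : R.maxCurv P k ≤ (P.kapH + P.lamU) * ‖R.u k‖ ^ 2 := by
    have := sq_nonneg ‖R.u k‖
    refine max_le ?_ ?_ <;> nlinarith
  have h4 := mul_le_mul_of_nonneg_left h2 (add_pos hH hU).le
  unfold trialDen
  linarith

/-- A vanishing merit parameter forces the noisy infeasible stationarity error to vanish along a
subsequence: each decrease of the merit parameter keeps it above a multiple of the reduction of the
linearized constraint violation. -/
theorem Standing.frequently_norm_jtcBar_lt (hP : P.Admissible opt) (hN : N.Admissible)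
    (hS : R.Standing P N Q opt) (hτ : Tendsto R.tau atTop (𝓝 0)) {ε : ℝ} (hε : 0 < ε) :
    ∃ᶠ k in atTop, ‖Q.jtcBar (R.x k)‖ < ε := by
  by_contra hcon
  rw [not_frequently, eventually_atTop] at hcon
  obtain ⟨k₀, hk₀⟩ := hcon
  set D := (P.kapG + N.epsG) * dirBound P N + (P.kapH + P.lamU) * tangentialBound P N ^ 2
  set ω := decreaseConst P N * ε ^ 2 / (P.kapC + N.epsC) with hω
  have hω0 : 0 < ω := by
    have h1 := decreaseConst_pos hP hN
    have h2 := hP.kapC_pos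
    have h3 := hN.epsC_nonneg
    positivity
  have hD : 0 < D := by
    have h1 := hP.kapG_pos
    have h2 := hN.epsG_nonneg
    have h3 := dirBound_pos hP hN
    have h4 := hP.kapH_pos
    have h5 := hP.lamU_mem.1
    positivity
  have hR : 0 < P.sigR := hP.sigC_mem.1.trans hP.sigR_mem.1
  have hT : 0 < 1 - P.sigTau := sub_pos.2 hP.sigTau_mem.2
  have hCR := one_sub_sigC_div_sigR_pos hP
  -- The updated merit parameter for the smallest possible numerator and the largest possible
  -- denominator.
  set δ := (1 - P.sigTau) * ((1 - P.sigC / P.sigR) * (P.sigR * ω) / D)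
  have hδ : 0 < δ := by positivity
  have hbound : ∀ k ≥ k₀, min δ (R.tau k₀) ≤ R.tau k := by
    intro k hk
    induction k, hk using Nat.le_induction with
    | base => exact min_le_right _ _
    | succ k hk ih =>
      rcases hS.tau_succ_cases k with h | ⟨hc, hF, hden, h, -⟩
      · rwa [h]
      · rw [h]
        refine min_le_of_left_le (mul_le_mul_of_nonneg_left ?_ hT.le)
        -- A decrease occurs only at infeasible iterates, so together with the assumed error bound
        -- the iterate lies in the level set for `ε`.
        have h1 := hS.le_normalRed hP hN hε ⟨not_lt.1 (hk₀ k hk), hc⟩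
        have h2 := (mul_le_mul_of_nonneg_left h1 hR.le).trans hF.1
        exact div_le_div₀ (mul_pos hCR hF.fullRed_pos).le
          (mul_le_mul_of_nonneg_left h2 hCR.le) hden (hS.trialDen_le hP hN k)
  have hlim := ge_of_tendsto hτ (eventually_atTop.2 ⟨k₀, hbound⟩)
  exact absurd hlim (not_le.2 (lt_min hδ (hS.tau_pos hP k₀)))

/-- Along a subsequence, the true infeasible stationarity error is of the order of the noise. -/
theorem Standing.frequently_norm_jtc_le (hP : P.Admissible opt) (hN : N.Admissible)
    (hS : R.Standing P N Q opt) (hτ : Tendsto R.tau atTop (𝓝 0)) {ε : ℝ} (hε : 0 < ε) :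
    ∃ᶠ k in atTop, ‖Q.jtc (R.x k)‖ ≤ N.epsC * (N.epsJ + P.kapJ) + P.kapC * N.epsJ + ε :=
  (hS.frequently_norm_jtcBar_lt hP hN hτ hε).mono fun k hk => by
    have := Problem.norm_jtc_le hS.smooth hS.noise (hS.iterates_mem k)
    linarith

theorem Standing.liminf_norm_jtc_le (hP : P.Admissible opt) (hN : N.Admissible)
    (hS : R.Standing P N Q opt) (hτ : Tendsto R.tau atTop (𝓝 0)) :
    liminf (fun k => ‖Q.jtc (R.x k)‖) atTop
      ≤ N.epsC * (N.epsJ + P.kapJ) + P.kapC * N.epsJ :=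
  liminf_le_of_forall_frequently_le_add (fun _ => norm_nonneg _)
    fun _ hε => hS.frequently_norm_jtc_le hP hN hτ hε

theorem Standing.liminf_norm_c_le (hP : P.Admissible opt) (hN : N.Admissible)
    (hS : R.Standing P N Q opt) (hτ : Tendsto R.tau atTop (𝓝 0)) {κσ : ℝ} (hκ : 0 < κσ)
    (hσ : R.SingularValuesBelow Q κσ) :
    liminf (fun k => ‖Q.c (R.x k)‖) atTop
      ≤ κσ⁻¹ * (N.epsC * (N.epsJ + P.kapJ) + P.kapC * N.epsJ) := by
  refine liminf_le_of_forall_frequently_le_add (fun _ => norm_nonneg _) fun ε hε => ?_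
  -- The slack is `κσ * ε`, so that dividing by `κσ` leaves `ε`.
  refine (hS.frequently_norm_jtc_le hP hN hτ (mul_pos hκ hε)).mono fun k hk => ?_
  have h := (mul_norm_le_norm_tr_of_singularValues _ hκ (hσ k) (Q.c (R.x k))).trans hk
  rw [← le_inv_mul_iff₀ hκ] at h
  refine h.trans (le_of_eq ?_)
  field_simp

end Run

/-! ### Comparison with the stated radius and order -/

theorem noise_error_le_mul_sqrt {P : Params} {N : Noise} {opt : StepOption}
    (hP : P.Admissible opt) (hN : N.Admissible) (hC : N.epsC ≤ 1) (hJ : N.epsJ ≤ 1) :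
    N.epsC * (N.epsJ + P.kapJ) + P.kapC * N.epsJ
      ≤ 2 * (1 + P.kapJ + P.kapC) * √(N.epsC + N.epsJ) := by
  have h1 := hN.epsC_nonneg
  have h2 := hN.epsJ_nonneg
  have h3 := hP.kapC_pos
  have h4 := hP.kapJ_pos
  -- For `s ≤ 2` one has `√s ≤ 2`, hence `s = √s * √s ≤ 2 * √s`; this is the factor two in `C`.
  have hs : N.epsC + N.epsJ ≤ 2 * √(N.epsC + N.epsJ) := by
    have h5 : √(N.epsC + N.epsJ) ≤ 2 := Real.sqrt_le_iff.2 ⟨by norm_num, by linarith⟩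
    nlinarith [Real.mul_self_sqrt (add_nonneg h1 h2), Real.sqrt_nonneg (N.epsC + N.epsJ)]
  have h6 : N.epsC * (N.epsJ + P.kapJ) + P.kapC * N.epsJ
      ≤ (1 + P.kapJ + P.kapC) * (N.epsC + N.epsJ) := by
    nlinarith [mul_nonneg h1 h3.le, mul_nonneg h2 h4.le]
  have h7 := mul_le_mul_of_nonneg_left hs (by positivity : 0 ≤ 1 + P.kapJ + P.kapC)
  linarith

theorem noise_error_le_radius (P : Params) (N : Noise) (opt : StepOption) (κd σv a σγ : ℝ) :
    N.epsC * (N.epsJ + P.kapJ) + P.kapC * N.epsJ ≤ radius P N opt κd σv a σγ :=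
  le_max_of_le_left (le_add_of_nonneg_right (Real.sqrt_nonneg _))

end NoisySQP

theorem theorem3p21 (n m : ℕ) (opt : NoisySQP.StepOption) (P : NoisySQP.Params)
    (hP : P.Admissible opt) :
    -- the constants in the bound exist, and depend only on the parameters and noise levels
    (∀ N : NoisySQP.Noise, N.Admissible →
      ∃ (σv κd : ℝ) (αlow : ℝ → ℝ), 0 < σv ∧ 0 < κd ∧ (∀ γ, 0 < γ → 0 < αlow γ) ∧
        ∀ (Q : NoisySQP.Problem n m) (R : NoisySQP.Run n m), R.Standing P N Q opt →
          Tendsto R.tau atTop (𝓝 0) →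
          R.NormalDecreaseConst N Q σv ∧ (∀ k, ‖R.d k‖ ≤ κd) ∧
            ∀ γ, 0 < γ → R.StepLowerBound N Q γ (αlow γ)) ∧
    -- the neighborhood bounds, for all constants with these properties
    (∀ (N : NoisySQP.Noise) (Q : NoisySQP.Problem n m) (R : NoisySQP.Run n m),
      N.Admissible → R.Standing P N Q opt → Tendsto R.tau atTop (𝓝 0) →
      ∀ σv κd γ a σγ : ℝ, 0 < σv → R.NormalDecreaseConst N Q σv →
        0 < κd → (∀ k, ‖R.d k‖ ≤ κd) →
        0 < γ → 0 < a → R.StepLowerBound N Q γ a → 0 < σγ → σγ < 1 →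
        liminf (fun k => ‖Q.jtc (R.x k)‖) atTop ≤ NoisySQP.radius P N opt κd σv a σγ ∧
        ∀ κσ : ℝ, 0 < κσ → R.SingularValuesBelow Q κσ →
          liminf (fun k => ‖Q.c (R.x k)‖) atTop
            ≤ κσ⁻¹ * NoisySQP.radius P N opt κd σv a σγ) ∧
    -- the order of the neighborhood in terms of the constraint noise
    (∃ C : ℝ, 0 ≤ C ∧
      ∀ (N : NoisySQP.Noise) (Q : NoisySQP.Problem n m) (R : NoisySQP.Run n m),
        N.Admissible → N.epsC ≤ 1 → N.epsJ ≤ 1 →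
        R.Standing P N Q opt → Tendsto R.tau atTop (𝓝 0) →
        liminf (fun k => ‖Q.jtc (R.x k)‖) atTop ≤ C * √(N.epsC + N.epsJ) ∧
        ∀ κσ : ℝ, 0 < κσ → R.SingularValuesBelow Q κσ →
          liminf (fun k => ‖Q.c (R.x k)‖) atTop ≤ κσ⁻¹ * (C * √(N.epsC + N.epsJ))) := by
  refine ⟨fun N hN => ?_, ?_, ?_⟩
  · exact ⟨NoisySQP.decreaseConst P N, NoisySQP.dirBound P N,
      fun γ => NoisySQP.stepBound P N γ opt, NoisySQP.decreaseConst_pos hP hN,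
      NoisySQP.dirBound_pos hP hN, fun γ hγ => NoisySQP.stepBound_pos hP hN hγ opt,
      fun Q R hS _ => ⟨hS.normalDecreaseConst hP hN, hS.norm_d_le hP hN,
        fun γ hγ => hS.stepLowerBound hP hN hγ⟩⟩
  · intro N Q R hN hS hτ σv κd γ a σγ _ _ _ _ _ _ _ _ _
    have hB := NoisySQP.noise_error_le_radius P N opt κd σv a σγ
    exact ⟨(hS.liminf_norm_jtc_le hP hN hτ).trans hB, fun κσ hκ hσ =>
      (hS.liminf_norm_c_le hP hN hτ hκ hσ).trans
        (mul_le_mul_of_nonneg_left hB (inv_nonneg.2 hκ.le))⟩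
  · have hC := hP.kapC_pos
    have hJ := hP.kapJ_pos
    refine ⟨2 * (1 + P.kapJ + P.kapC), by positivity, ?_⟩
    intro N Q R hN hεC hεJ hS hτ
    have hB := NoisySQP.noise_error_le_mul_sqrt hP hN hεC hεJ
    exact ⟨(hS.liminf_norm_jtc_le hP hN hτ).trans hB, fun κσ hκ hσ =>
      (hS.liminf_norm_c_le hP hN hτ hκ hσ).trans
        (mul_le_mul_of_nonneg_left hB (inv_nonneg.2 hκ.le))⟩
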